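/- **Proposition (Deep network, warm-up case).** *Inputs and norm.* Let $\mathcal X$ be a set of sequences $X=(x_t)_{t\in\mathbb Z}$ in $\mathbb R^d$ with $\|x_t\|_2\le 1$, let $S$ be the set of tokens occurring in $\mathcal X$, and put $|||F|||=\sup_{t\in\mathbb Z}\sup_{X\in\mathcal X}|F_t(X)|$. For a function $f$ on a set $U\subset\mathbb R^N$ and a fixed $p\in[1,\infty]$ let $\|f\|_{\mathcal B}=\inf_\rho\big(\mathbb E_\rho[|a|^p(\|b\|_1+|c|)^p]\big)^{1/p}$, the infimum over probability laws $\rho$ of $(a,b,c)$ with $f(x)=\mathbb E_\rho[a\,\sigma(b^\top x+c)]$ on $U$, where $\sigma$ is the ReLU; $\mathcal B$ consists of the continuous $f$ with $\|f\|_{\mathcal B}<\infty$. *Targets.* For $M\ge 0$ let $\mathbf H_t(X)=f(x_t,x_{t-t_1},\dots,x_{t-t_M})$ with $t_i=g_i(x_t)$, where $g_i:S\to\{1,\dots,T_i\}$ is in $\mathcal B$ on $S$, and $f$ is in $\mathcal B$ and Lipschitz for the Euclidean norm, with best constant $\|f\|_{\rm Lip}$, on the set of all $(M+1)$-tuples of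 vectors in the closed Euclidean unit ball of $\mathbb R^d$ (viewed in $\mathbb R^{(M+1)d}$). *Transformers.* Let $\mathtt{type}\in\{\mathrm{lin},\log\}$, $\phi_{\rm lin}(s)=-s$, $\phi_{\log}(s)=-\log s$ for $s\ge1$ and $\phi_{\log}(0)=-\infty$. An $L$-layer, $H$-head, $m$-width normalization-free Transformer with $\mathtt{type}$-RPE and precision is given by an affine embedding $x^{(0)}_t=W_Ex_t+b_E\in\mathbb R^D$ ($D$ arbitrary) and $$x_t^{(l-1/2)}=x_t^{(l-1)}+W_O^{(l)}\sum_{h=1}^H W_V^{(l,h)}\sum_{s\ge0}x^{(l-1)}_{t-s}\exp\!\Big(\big\langle W_Q^{(l,h)}x_t^{(l-1)},W_K^{(l,h)}x_{t-s}^{(l-1)}\big\rangle+p^{(l,h)}\phi_{\mathtt{type}}(s)\Big),\quad 1\le l\le L,$$ with $D\times D$ matrices and $p^{(l,h)}>0$; then $x_t^{(l)}=x_t^{(l-1/2)}+\widetilde{\rm FFN}^{(l)}(x_t^{(l-1/2)})$ for $l<L$, and the output is ${\rm FFN}^{(L)}(x_t^{(L-1/2)})\in\mathbb R$. Here ${\rm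 FFN}^{(l)}(x)=\sum_{k=1}^m a_k^{(l)}\sigma(b_k^{(l)\top}x+c_k^{(l)})$, and $\widetilde{\rm FFN}=[{\rm FFN}]$ for lin, $\widetilde{\rm FFN}=\log[\exp({\rm FFN})]$ for log, coordinatewise, with $[\cdot]$ rounding to the nearest integer (ties upwards). For all inputs in $\mathcal X$ all series must converge and no logarithm of $0$ may occur. *Claim.* There are absolute constants $C_1,C_2>0$, $k_1,k_2\in\mathbb N$, and constants $C(n)$ depending only on $n$, such that the following holds for all $\mathtt{type},d,M,p,\mathcal X,\mathbf H$ as above and all integers $n,H,m\ge1$. Let $A=\max_{i\le M}\|g_i\|_{\mathcal B}^2$ for lin and $A=\max_{i\le M}\|\log g_i\|_{\mathcal B}^2T_i^2$ for log (norms on $S$). If $A<\infty$ and $m\ge C_1A\,(1+\log(1+A))^{k_1}$, then there is an $(M+1)$-layer, $H$-head, $m$-width Transformer $\mathbf{TF}$ of this kind with $$|||\mathbf H-\mathbf{TF}|||\le \mathcal E_{\rm FFN}+\|f\|_{\rm Lip}\,\mathcal E_{\rm Attn},\qquad \mathcal E_{\rm FFN}=C_2(1+\log m)^{k_2}\frac{\|f\|_{\mathcal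 B}}{\sqrt m},$$ $$\mathcal E_{\rm Attn}=\begin{cases}\dfrac{C(n)}{H^n}\sqrt{\sum_{l=1}^M e^{0.02(n+1)T_l}},&\mathtt{type}=\mathrm{lin},\\[2mm]\dfrac{C(n)}{H^n}\sqrt{\sum_{l=1}^M T_l^{2.02(n+1)}},&\mathtt{type}=\log.\end{cases}$$ -/

import Mathlib

open MeasureTheory
open scoped ENNReal NNReal Matrix

noncomputable section

/-! ### Input sequences -/

/-- Tokens are vectors of `ℝ^d` with the Euclidean norm. -/
abbrev Token (d : ℕ) : Type := EuclideanSpace ℝ (Fin d)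

/-- Two-sided infinite input sequences `(x_t)_{t ∈ ℤ}`. -/
abbrev TokenSeq (d : ℕ) : Type := ℤ → Token d

/-- The set of all tokens that occur in some sequence of `𝒳`. -/
def tokenSet {d : ℕ} (𝒳 : Set (TokenSeq d)) : Set (Token d) :=
  {x | ∃ X ∈ 𝒳, ∃ t : ℤ, X t = x}

/-- The norm `sup_t sup_{X ∈ 𝒳} |F_t(X)|` of a (scalar) sequence map, with values in `[0, ∞]`. -/
def seqNorm {d : ℕ} (𝒳 : Set (TokenSeq d)) (F : ℤ → TokenSeq d → ℝ) : ℝ≥0∞ :=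
  ⨆ t : ℤ, ⨆ X ∈ 𝒳, ‖F t X‖ₑ

/-! ### Barron space and Lipschitz norm -/

/-- The activation function. -/
def relu (z : ℝ) : ℝ := max z 0

/-- The Barron norm with exponent `p` of `f` on the domain `U`: the infimum of
`(E_ρ [|a|^p (‖b‖₁ + |c|)^p])^(1/p)` (essential supremum for `p = ∞`) over all probability laws `ρ`
of `(a, b, c)` with `f(x) = E_ρ [a σ(b ⬝ x + c)]` for `x ∈ U`. It is `∞` if there is none.
(If the value for `ρ` is finite and `p ≥ 1`, the expectation that represents `f` converges
absolutely.) -/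
def barronNorm {ι : Type*} [Fintype ι] (p : ℝ≥0∞) (U : Set (EuclideanSpace ℝ ι))
    (f : EuclideanSpace ℝ ι → ℝ) : ℝ≥0∞ :=
  ⨅ ρ ∈ {ρ : Measure (ℝ × (ι → ℝ) × ℝ) | IsProbabilityMeasure ρ ∧
      ∀ x ∈ U, f x = ∫ θ, θ.1 * relu (θ.2.1 ⬝ᵥ x.ofLp + θ.2.2) ∂ρ},
    eLpNorm (fun θ : ℝ × (ι → ℝ) × ℝ => |θ.1| * ((∑ i, |θ.2.1 i|) + |θ.2.2|)) p ρ

/-- Membership in the Barron space over the domain `U`. -/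
def InBarron {ι : Type*} [Fintype ι] (p : ℝ≥0∞) (U : Set (EuclideanSpace ℝ ι))
    (f : EuclideanSpace ℝ ι → ℝ) : Prop :=
  ContinuousOn f U ∧ barronNorm p U f ≠ ∞

/-- The best Lipschitz constant of `f` on `U` with respect to the Euclidean norm. -/
def lipNorm {ι : Type*} [Fintype ι] (U : Set (EuclideanSpace ℝ ι))
    (f : EuclideanSpace ℝ ι → ℝ) : ℝ :=
  ((sInf {K : ℝ≥0 | LipschitzOnWith K f U} : ℝ≥0) : ℝ)

/-! ### Targets with adaptive, long but sparse memories (no nesting) -/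

/-- The concatenation of `k` tokens of `ℝ^d`, a vector of `ℝ^{kd}` (Euclidean norm). -/
def concatTokens {k d : ℕ} (x : Fin k → Token d) : EuclideanSpace ℝ (Fin k × Fin d) :=
  WithLp.toLp 2 (fun ij => x ij.1 ij.2)

/-- Concatenations of `k` tokens of norm at most one: the domain of the readout function. -/
def readoutDomain (k d : ℕ) : Set (EuclideanSpace ℝ (Fin k × Fin d)) :=
  {z | ∃ x : Fin k → Token d, (∀ j, ‖x j‖ ≤ 1) ∧ concatTokens x = z}

/-- A target `y_t = f(x_t, x_{t - g_1(x_t)}, …, x_{t - g_M(x_t)})` on the input set `𝒳`. -/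
structure AdaptiveTarget (d M : ℕ) (p : ℝ≥0∞) (𝒳 : Set (TokenSeq d)) where
  /-- the readout function -/
  f : EuclideanSpace ℝ (Fin (M + 1) × Fin d) → ℝ
  /-- the memory functions -/
  g : Fin M → Token d → ℕ
  /-- upper bounds for the memory functions -/
  T : Fin M → ℕ
  f_barron : InBarron p (readoutDomain (M + 1) d) f
  f_lip : ∃ K : ℝ≥0, LipschitzOnWith K f (readoutDomain (M + 1) d)
  g_barron : ∀ i, InBarron p (tokenSet 𝒳) (fun x => (g i x : ℝ))
  one_le_g : ∀ i, ∀ x ∈ tokenSet 𝒳, 1 ≤ g i x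
  g_le : ∀ i, ∀ x ∈ tokenSet 𝒳, g i x ≤ T i

/-- The sequence map `X ↦ (H_t(X))_t` of a target. -/
def AdaptiveTarget.map {d M : ℕ} {p : ℝ≥0∞} {𝒳 : Set (TokenSeq d)}
    (𝓗 : AdaptiveTarget d M p 𝒳) (t : ℤ) (X : TokenSeq d) : ℝ :=
  𝓗.f (concatTokens (Fin.cons (X t) fun i => X (t - (𝓗.g i (X t) : ℤ))))

/-! ### Transformers -/

/-- The two kinds of relative positional encoding. -/
inductive RPEType : Type
  | lin
  | log

/-- The unnormalized attention weight `exp(q + p φ(s))` of the token at distance `s`, where `q` is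
the dot product, `φ(s) = -s` for `lin`, and `φ(s) = -log s` for `s ≥ 1`, `φ(0) = -∞` for `log`;
so in the last case the weight at distance `0` is `exp(-∞) = 0`. -/
def attnWeight (type : RPEType) (p q : ℝ) (s : ℕ) : ℝ :=
  match type with
  | .lin => Real.exp (q - p * s)
  | .log => if s = 0 then 0 else Real.exp (q - p * Real.log s)

/-- Multi-head attention layer on `ℝ^D` with `H` heads. -/
structure AttnLayer (D H : ℕ) where
  WQ : Fin H → Matrix (Fin D) (Fin D) ℝ
  WK : Fin H → Matrix (Fin D) (Fin D) ℝ
  WV : Fin H → Matrix (Fin D) (Fin D) ℝ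
  WO : Matrix (Fin D) (Fin D) ℝ
  p : Fin H → ℝ
  p_pos : ∀ h, 0 < p h

/-- The term at distance `s` of the attention series of head `h` at position `t`. -/
def AttnLayer.term {D H : ℕ} (A : AttnLayer D H) (type : RPEType) (x : ℤ → Fin D → ℝ)
    (t : ℤ) (h : Fin H) (s : ℕ) : Fin D → ℝ :=
  attnWeight type (A.p h) ((A.WQ h *ᵥ x t) ⬝ᵥ (A.WK h *ᵥ x (t - s))) s • x (t - s)

/-- Normalization-free multi-head attention. -/
def AttnLayer.apply {D H : ℕ} (A : AttnLayer D H) (type : RPEType) (x : ℤ → Fin D → ℝ)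
    (t : ℤ) : Fin D → ℝ :=
  A.WO *ᵥ ∑ h, A.WV h *ᵥ ∑' s : ℕ, A.term type x t h s

/-- Two-layer ReLU network `x ↦ ∑_{k ≤ m} a_k σ(b_k ⬝ x + c_k)` with `m` neurons and coefficients
`a_k` in `V`. -/
structure TwoLayerNet (D m : ℕ) (V : Type) where
  a : Fin m → V
  b : Fin m → Fin D → ℝ
  c : Fin m → ℝ

def TwoLayerNet.apply {D m : ℕ} {V : Type} [AddCommMonoid V] [Module ℝ V]
    (F : TwoLayerNet D m V) (x : Fin D → ℝ) : V :=
  ∑ k, relu (F.b k ⬝ᵥ x + F.c k) • F.a k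

/-- The precision (rounding) operation: `[z]` for `lin`, and `log [exp z]` for `log`. -/
def precision (type : RPEType) (z : ℝ) : ℝ :=
  match type with
  | .lin => (round z : ℝ)
  | .log => Real.log (round (Real.exp z) : ℝ)

/-- The parameters of a Transformer with `L + 1` layers, embedding dimension `D`, `H` heads and
FFN width `m`. The last FFN is the scalar readout. -/
structure Transformer (d D L H m : ℕ) where
  WE : Matrix (Fin D) (Fin d) ℝ
  bE : Fin D → ℝ
  attn : Fin (L + 1) → AttnLayer D H
  ffn : Fin L → TwoLayerNet D m (Fin D → ℝ)
  readout : TwoLayerNet D m ℝ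

namespace Transformer

variable {d D L H m : ℕ}

/-- The token sequence after the attention block (with residual connection) of layer `l`. -/
def afterAttn (N : Transformer d D L H m) (type : RPEType) (l : Fin (L + 1))
    (x : ℤ → Fin D → ℝ) (t : ℤ) : Fin D → ℝ :=
  x t + (N.attn l).apply type x t

/-- The input of layer `l` (counted from `0`). All layers but the last consist of attention with
residual connection and an FFN with precision and residual connection. -/
def layerInput (N : Transformer d D L H m) (type : RPEType) (X : TokenSeq d) :
    Fin (L + 1) → ℤ → Fin D → ℝ :=
  Fin.induction (motive := fun _ => ℤ → Fin D → ℝ)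
    (fun t => N.WE *ᵥ (X t).ofLp + N.bE)
    (fun l x t => N.afterAttn type l.castSucc x t +
      fun i => precision type ((N.ffn l).apply (N.afterAttn type l.castSucc x t) i))

/-- The output: the last layer has no residual connection at its FFN and no rounding. -/
def output (N : Transformer d D L H m) (type : RPEType) (t : ℤ) (X : TokenSeq d) : ℝ :=
  N.readout.apply (N.afterAttn type (Fin.last L) (N.layerInput type X (Fin.last L)) t)

/-- The Transformer is well defined on `𝒳`: every attention series converges, and no logarithm
of `0` is taken in the precision operation. -/
def WellDefined (N : Transformer d D L H m) (type : RPEType) (𝒳 : Set (TokenSeq d)) : Prop :=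
  (∀ X ∈ 𝒳, ∀ (l : Fin (L + 1)) (t : ℤ) (h : Fin H),
    Summable ((N.attn l).term type (N.layerInput type X l) t h)) ∧
  (type = RPEType.log → ∀ X ∈ 𝒳, ∀ (l : Fin L) (t : ℤ) (i : Fin D),
    0 < round (Real.exp ((N.ffn l).apply
      (N.afterAttn type l.castSucc (N.layerInput type X l.castSucc) t) i)))

end Transformer

/-- The sequence maps on `𝒳` that are given by an `L`-layer, `H`-head, `m`-width normalization-free
Transformer with `type`-RPE and precision (of any embedding dimension). -/
def transformerClass {d : ℕ} (type : RPEType) (𝒳 : Set (TokenSeq d)) (L H m : ℕ) :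
    Set (ℤ → TokenSeq d → ℝ) :=
  {F | ∃ (D L' : ℕ) (N : Transformer d D L' H m),
    L = L' + 1 ∧ N.WellDefined type 𝒳 ∧ F = N.output type}

/-! ### The quantities in the approximation rate -/

/-- `max_i ‖g_i‖_B²` for `lin`, and `max_i ‖log g_i‖_B² T_i²` for `log` (possibly `∞`). -/
def memoryComplexity {d M : ℕ} {p : ℝ≥0∞} {𝒳 : Set (TokenSeq d)} (type : RPEType)
    (𝓗 : AdaptiveTarget d M p 𝒳) : ℝ≥0∞ :=
  match type with
  | .lin => ⨆ i, barronNorm p (tokenSet 𝒳) (fun x => (𝓗.g i x : ℝ)) ^ 2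
  | .log => ⨆ i, barronNorm p (tokenSet 𝒳) (fun x => Real.log (𝓗.g i x)) ^ 2 * (𝓗.T i : ℝ≥0∞) ^ 2

/-- `sqrt(∑_l e^{0.02 (n+1) T_l})` for `lin`, and `sqrt(∑_l T_l^{2.02 (n+1)})` for `log`. -/
def memoryLength {M : ℕ} (type : RPEType) (n : ℕ) (T : Fin M → ℕ) : ℝ :=
  match type with
  | .lin => Real.sqrt (∑ l, Real.exp (0.02 * (n + 1) * T l))
  | .log => Real.sqrt (∑ l, (T l : ℝ) ^ (2.02 * ((n : ℝ) + 1)))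

end

noncomputable section

/-! ### Rademacher averages -/

/-! The network computes every delay `g_j(x_t)` exactly, uses it to retrieve an approximation of the
delayed token by attention, and applies a sampled version of the Barron function `f` to the
retrieved tuple. Only retrieval and sampling cost accuracy: rounding repairs the stored delays and
can be made harmless for the readout.

Sampling. A function of Barron norm below `V` is `V` times an element of the closed convex hull, in
the uniform norm, of the neurons with unit weights (`barron_mem_closure`, by Hahn–Banach). A convex
combination is close to a long list of equally weighted neurons, and this list is halved repeatedly.
By the contraction principle for the ReLU and the parallelogram law, some splitting of `n` neurons
has discrepancy `O(R √n)` uniformly on the ball of radius `R`. The costs of the halvings form a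
geometric series, so `K` neurons give error `O(R V / √K)` with no dimension or logarithm
(`exists_reduction`, `exists_listNet_approx`). Once the error for `g_j` or `log g_j` is below the
rounding tolerance, the stored value is exact (`exists_memNet`).

Retrieval. With the stored value of a delay `t` in the query, the weight at distance `s` is a power
of `e^{0.01(t-s)}`, respectively `(t/s)^{0.01}`, a quantity that equals 1 exactly at `s = t`. Heads
with exponents `0.01 i` therefore realize polynomials in it, up to a fixed initial power needed for
summability. The `n`-th power of a normalized `T_{2N+1}(u)/u` is 1 at the peak and of order `N^{-n}`
away from it, which gives the rate `H^{-n}` (`exists_polynomial_kernel`, `exists_headKernel`).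
Rescaling to `ℓ¹` norm at most one keeps the retrieved tokens in the unit ball, where the Lipschitz
bound of `f` applies.

Depth. The readout domain has radius `√(M+1)`, so a single layer of width `m` would lose a factor
`√M`. Feed-forward layer `l` stores memories `2l` and `2l+1`, and attention block `l+1` retrieves
both, each with half of the heads. All tokens are thus present in the last `M/2 + 1` layers, which
share the readout neurons and add their outputs in one coordinate; their larger number compensates
`√M` (`exists_layer_split`, `sampling_error_le`). No logarithmic factors are needed: `k₁ = k₂ = 0`.
-/

theorem abs_relu_sub_relu_le (x y : ℝ) : |relu x - relu y| ≤ |x - y| := by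
  unfold relu
  exact abs_max_sub_max_le_abs x y 0

theorem relu_nonneg (x : ℝ) : 0 ≤ relu x := le_max_right _ _

theorem relu_le_abs (x : ℝ) : relu x ≤ |x| := max_le (le_abs_self x) (abs_nonneg x)

theorem relu_zero : relu 0 = 0 := max_self 0

theorem relu_mul_of_nonneg {r : ℝ} (hr : 0 ≤ r) (x : ℝ) : relu (r * x) = r * relu x := by
  unfold relu
  rw [mul_max_of_nonneg _ _ hr, mul_zero]

theorem continuous_relu : Continuous relu := continuous_id.max continuous_const

/-- The average of `Ψ (A + ∑ ± u)` over all choices of signs. -/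
def radAvg {I : Type*} (Ψ : (I → ℝ) → ℝ) : List (I → ℝ) → (I → ℝ) → ℝ
  | [], A => Ψ A
  | u :: us, A => (radAvg Ψ us (A + u) + radAvg Ψ us (A - u)) / 2

/-- The one-step comparison behind the contraction principle. -/
def IsContractive {I : Type*} (Ψ : (I → ℝ) → ℝ) : Prop :=
  ∀ A u v : I → ℝ, (∀ i j, |v i - v j| ≤ |u i - u j|) → Ψ (A + v) + Ψ (A - v) ≤ Ψ (A + u) + Ψ (A - u)

theorem IsContractive.radAvg {I : Type*} {Ψ : (I → ℝ) → ℝ} (hΨ : IsContractive Ψ)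
    (us : List (I → ℝ)) : IsContractive (radAvg Ψ us) := by
  induction us with
  | nil => exact hΨ
  | cons w us ih =>
    intro A u v h
    have h1 := ih (A + w) u v h
    have h2 := ih (A - w) u v h
    simp only [_root_.radAvg]
    rw [add_right_comm A v w, add_sub_right_comm A v w, sub_add_eq_add_sub A v w, sub_right_comm A v w,
      add_right_comm A u w, add_sub_right_comm A u w, sub_add_eq_add_sub A u w, sub_right_comm A u w]
    linarith

/-- Contraction principle: the summands are exchanged one at a time, and averaging over the
remaining signs preserves the one-step comparison. -/
theorem IsContractive.radAvg_map_le {I α : Type*} {Ψ : (I → ℝ) → ℝ} (hΨ : IsContractive Ψ)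
    (φ ψ : α → I → ℝ) (L : List α) (h : ∀ q ∈ L, ∀ i j, |φ q i - φ q j| ≤ |ψ q i - ψ q j|)
    (A : I → ℝ) : _root_.radAvg Ψ (L.map φ) A ≤ _root_.radAvg Ψ (L.map ψ) A := by
  induction L generalizing A with
  | nil => exact le_rfl
  | cons q L ih =>
    have hL : ∀ q ∈ L, ∀ i j, |φ q i - φ q j| ≤ |ψ q i - ψ q j| :=
      fun q hq => h q (List.mem_cons_of_mem _ hq)
    have h1 := ih hL (A + φ q)
    have h2 := ih hL (A - φ q)
    have h3 := hΨ.radAvg (L.map ψ) A (ψ q) (φ q) (h q List.mem_cons_self)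
    simp only [List.map_cons, _root_.radAvg]
    linarith

/-- The oscillation of a function on a finite set. -/
def spread {I : Type*} (A : I → ℝ) : ℝ := (⨆ i, A i) + ⨆ i, -A i

/-- If `i` and `j` maximize `A + v` and `A - v`, then `v i - v j ≤ |u i - u j|`, and the sign of `u
i - u j` decides which of `i`, `j` to test in `A + u` and which in `A - u`. The spread adds this
inequality for `A` and for `-A`. -/
theorem isContractive_spread {I : Type*} [Finite I] [Nonempty I] :
    IsContractive (spread (I := I)) := by
  have key : ∀ A u v : I → ℝ, (∀ i j, |v i - v j| ≤ |u i - u j|) →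
      (⨆ i, (A i + v i)) + (⨆ i, (A i - v i)) ≤ (⨆ i, (A i + u i)) + ⨆ i, (A i - u i) := by
    intro A u v h
    obtain ⟨i, hi⟩ := exists_eq_ciSup_of_finite (f := fun i => A i + v i)
    obtain ⟨j, hj⟩ := exists_eq_ciSup_of_finite (f := fun i => A i - v i)
    rw [← hi, ← hj]
    have b1 := fun k => le_ciSup (Set.finite_range fun i => A i + u i).bddAbove k
    have b2 := fun k => le_ciSup (Set.finite_range fun i => A i - u i).bddAbove k
    have h1 := b1 i
    have h2 := b1 j
    have h3 := b2 i
    have h4 := b2 j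
    have h5 := (le_abs_self _).trans (h i j)
    rcases abs_cases (u i - u j) with ⟨h6, _⟩ | ⟨h6, _⟩ <;> linarith
  intro A u v h
  have h1 := key A u v h
  have h2 := key (-A) u v h
  have e1 : ∀ i, -A i + v i = -(A i - v i) := fun i => by ring
  have e2 : ∀ i, -A i - v i = -(A i + v i) := fun i => by ring
  have e3 : ∀ i, -A i + u i = -(A i - u i) := fun i => by ring
  have e4 : ∀ i, -A i - u i = -(A i + u i) := fun i => by ring
  simp only [Pi.neg_apply, e1, e2, e3, e4] at h2
  simp only [spread, Pi.add_apply, Pi.sub_apply]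
  linarith

/-- All ways to split a list into two complementary sublists. -/
def splits {α : Type*} : List α → List (List α × List α)
  | [] => [([], [])]
  | q :: L => (splits L).flatMap fun s => [(q :: s.1, s.2), (s.1, q :: s.2)]

theorem length_add_length_of_mem_splits {α : Type*} {L : List α} {s : List α × List α}
    (hs : s ∈ splits L) : s.1.length + s.2.length = L.length := by
  induction L generalizing s with
  | nil => simp_all [splits]
  | cons q L ih =>
    simp only [splits, List.mem_flatMap, List.mem_cons, List.not_mem_nil, or_false] at hs
    obtain ⟨r, hr, rfl | rfl⟩ := hs <;> have := ih hr <;> simp <;> omega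

theorem mem_of_mem_splits {α : Type*} {L : List α} {s : List α × List α}
    (hs : s ∈ splits L) : (∀ q ∈ s.1, q ∈ L) ∧ ∀ q ∈ s.2, q ∈ L := by
  induction L generalizing s with
  | nil => simp_all [splits]
  | cons q L ih =>
    simp only [splits, List.mem_flatMap, List.mem_cons, List.not_mem_nil, or_false] at hs
    obtain ⟨r, hr, rfl | rfl⟩ := hs <;> have := ih hr <;> simp <;> tauto

theorem sum_map_of_mem_splits {α V : Type*} [AddCommMonoid V] (φ : α → V) {L : List α}
    {s : List α × List α} (hs : s ∈ splits L) :
    (s.1.map φ).sum + (s.2.map φ).sum = (L.map φ).sum := by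
  induction L generalizing s with
  | nil => simp_all [splits]
  | cons q L ih =>
    simp only [splits, List.mem_flatMap, List.mem_cons, List.not_mem_nil, or_false] at hs
    obtain ⟨r, hr, rfl | rfl⟩ := hs <;> simp only [List.map_cons, List.sum_cons, ← ih hr] <;> abel

/-- Some choice of signs does not exceed the average; a split records which summands carry a plus
and which a minus. -/
theorem exists_mem_splits_le_radAvg {I α : Type*} (Ψ : (I → ℝ) → ℝ) (φ : α → I → ℝ) (L : List α)
    (A : I → ℝ) :
    ∃ s ∈ splits L, Ψ (A + (s.1.map φ).sum - (s.2.map φ).sum) ≤ radAvg Ψ (L.map φ) A := by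
  induction L generalizing A with
  | nil => exact ⟨([], []), by simp [splits], by simp [radAvg]⟩
  | cons q L ih =>
    obtain ⟨s, hs, h1⟩ := ih (A + φ q)
    obtain ⟨r, hr, h2⟩ := ih (A - φ q)
    simp only [splits, List.mem_flatMap, List.mem_cons, List.not_mem_nil, or_false, List.map_cons,
      radAvg]
    rcases le_total (radAvg Ψ (L.map φ) (A + φ q)) (radAvg Ψ (L.map φ) (A - φ q)) with h | h
    · refine ⟨(q :: s.1, s.2), ⟨s, hs, Or.inl rfl⟩, ?_⟩
      simp only [List.map_cons, List.sum_cons, ← add_assoc]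
      linarith
    · refine ⟨(r.1, q :: r.2), ⟨r, hr, Or.inr rfl⟩, ?_⟩
      simp only [List.map_cons, List.sum_cons]
      rw [show A + (r.1.map φ).sum - (φ q + (r.2.map φ).sum)
        = A - φ q + (r.1.map φ).sum - (r.2.map φ).sum by abel]
      linarith

/-! ### Halving a list of neurons with uniform error on a ball -/

section Halving

variable {F : Type*} [NormedAddCommGroup F] [InnerProductSpace ℝ F]

theorem spread_inner_le {I : Type*} [Nonempty I] (z : I → F) {R : ℝ}
    (hz : ∀ i, ‖z i‖ ≤ R) (w : F) : spread (fun i => inner ℝ w (z i)) ≤ 2 * R * ‖w‖ := by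
  have h : ∀ i, |inner ℝ w (z i)| ≤ R * ‖w‖ := fun i =>
    (abs_real_inner_le_norm _ _).trans (by
      rw [mul_comm]; exact mul_le_mul_of_nonneg_right (hz i) (norm_nonneg w))
  have h1 : (⨆ i, inner ℝ w (z i)) ≤ R * ‖w‖ := ciSup_le fun i => (abs_le.1 (h i)).2
  have h2 : (⨆ i, -inner ℝ w (z i)) ≤ R * ‖w‖ := ciSup_le fun i => by
    have := (abs_le.1 (h i)).1
    linarith
  unfold spread
  linarith

theorem half_sqrt_add_sqrt_le {x y s : ℝ} (hx : 0 ≤ x) (hy : 0 ≤ y) (h : x + y = 2 * s) :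
    (Real.sqrt x + Real.sqrt y) / 2 ≤ Real.sqrt s := by
  apply Real.le_sqrt_of_sq_le
  nlinarith [sq_nonneg (Real.sqrt x - Real.sqrt y), Real.sq_sqrt hx, Real.sq_sqrt hy]

/-- For linear functionals the spread is at most `2R` times the norm of the signed sum. The
parallelogram law removes the cross terms in the mean square, and concavity of the square root
passes to the mean norm. -/
theorem radAvg_spread_inner_le {I : Type*} [Nonempty I] (z : I → F) {R : ℝ}
    (hR : 0 ≤ R) (hz : ∀ i, ‖z i‖ ≤ R) (L : List (ℝ × F)) (hL : ∀ q ∈ L, ‖q.2‖ ≤ 1) (w : F) :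
    radAvg spread (L.map fun q i => inner ℝ q.2 (z i)) (fun i => inner ℝ w (z i)) ≤
      2 * R * Real.sqrt (‖w‖ ^ 2 + L.length) := by
  induction L generalizing w with
  | nil =>
    simp only [List.map_nil, radAvg, List.length_nil, Nat.cast_zero, add_zero,
      Real.sqrt_sq (norm_nonneg w)]
    exact spread_inner_le z hz w
  | cons q L ih =>
    have hL' : ∀ q ∈ L, ‖q.2‖ ≤ 1 := fun q hq => hL q (List.mem_cons_of_mem _ hq)
    have h1 := ih hL' (w + q.2)
    have h2 := ih hL' (w - q.2)
    have e1 : (fun i => inner ℝ (w + q.2) (z i))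
        = (fun i => inner ℝ w (z i)) + fun i => inner ℝ q.2 (z i) := by
      ext i; simp [inner_add_left]
    have e2 : (fun i => inner ℝ (w - q.2) (z i))
        = (fun i => inner ℝ w (z i)) - fun i => inner ℝ q.2 (z i) := by
      ext i; simp [inner_sub_left]
    rw [e1] at h1
    rw [e2] at h2
    simp only [List.map_cons, radAvg, List.length_cons, Nat.cast_add, Nat.cast_one]
    have hq : ‖q.2‖ ^ 2 ≤ 1 := by
      have := hL q List.mem_cons_self
      nlinarith [norm_nonneg q.2]
    have hp := parallelogram_law_with_norm ℝ w q.2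
    have h3 := half_sqrt_add_sqrt_le (x := ‖w + q.2‖ ^ 2 + L.length) (y := ‖w - q.2‖ ^ 2 + L.length)
      (s := ‖w‖ ^ 2 + ‖q.2‖ ^ 2 + L.length) (by positivity) (by positivity) (by nlinarith)
    have h4 : Real.sqrt (‖w‖ ^ 2 + ‖q.2‖ ^ 2 + L.length) ≤ Real.sqrt (‖w‖ ^ 2 + (L.length + 1)) :=
      Real.sqrt_le_sqrt (by linarith)
    nlinarith

/-- The unnormalized two-layer network on an inner product space given by a list of pairs of an
outer and an inner weight. -/
def netSum (L : List (ℝ × F)) (z : F) : ℝ := (L.map fun q => q.1 * relu (inner ℝ q.2 z)).sum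

/-- All weights have norm at most one. -/
def UnitWeights (L : List (ℝ × F)) : Prop := ∀ q ∈ L, |q.1| ≤ 1 ∧ ‖q.2‖ ≤ 1

/-- If every split failed somewhere, one bad point per split would give a finite set. On it,
contraction replaces each neuron by its linear functional, and the average bound produces a split
without a bad point. No covering of the ball is needed. -/
theorem exists_mem_splits_abs_sub_le (L : List (ℝ × F)) (hL : UnitWeights L) {R : ℝ} (hR : 0 ≤ R) :
    ∃ s ∈ splits L, ∀ z : F, ‖z‖ ≤ R → |netSum s.1 z - netSum s.2 z| ≤
      2 * R * Real.sqrt L.length := by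
  by_contra! hcon
  choose z hz using fun s : {s // s ∈ splits L} => hcon s.1 s.2
  have : Finite {s // s ∈ splits L} := (splits L).finite_toSet
  -- The origin is adjoined because every bias-free network vanishes there, so the spread bounds the
  -- absolute value at the other points.
  let y : Option {s // s ∈ splits L} → F := fun o => o.elim 0 z
  have hy : ∀ i, ‖y i‖ ≤ R := by
    rintro (_ | i)
    · simpa [y] using hR
    · exact (hz i).1
  let φ : ℝ × F → Option {s // s ∈ splits L} → ℝ := fun q i => q.1 * relu (inner ℝ q.2 (y i))
  obtain ⟨s, hs, h1⟩ := exists_mem_splits_le_radAvg spread φ L 0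
  have h2 := isContractive_spread.radAvg_map_le φ (fun q i => inner ℝ q.2 (y i)) L (by
    intro q hq i j
    simp only [φ]
    rw [← mul_sub, abs_mul]
    calc |q.1| * |relu (inner ℝ q.2 (y i)) - relu (inner ℝ q.2 (y j))|
        ≤ 1 * |relu (inner ℝ q.2 (y i)) - relu (inner ℝ q.2 (y j))| :=
          mul_le_mul_of_nonneg_right (hL q hq).1 (abs_nonneg _)
      _ ≤ _ := by rw [one_mul]; exact abs_relu_sub_relu_le _ _) 0
  have h3 := radAvg_spread_inner_le y hR hy L (fun q hq => (hL q hq).2) 0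
  simp only [inner_zero_left, norm_zero, ne_eq, OfNat.ofNat_ne_zero, not_false_eq_true, zero_pow,
    zero_add] at h3
  have h4 : spread ((s.1.map φ).sum - (s.2.map φ).sum) ≤ 2 * R * Real.sqrt L.length := by
    rw [zero_add] at h1
    exact (h1.trans h2).trans h3
  have hsum : ∀ l : List (ℝ × F), ∀ i, (l.map φ).sum i = netSum l (y i) := by
    intro l i
    induction l with
    | nil => rfl
    | cons q l ih => simp [netSum, φ] at ih ⊢; rw [ih]
  have h0 : ∀ l : List (ℝ × F), netSum l 0 = 0 := by
    intro l
    induction l with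
    | nil => rfl
    | cons q l ih => simp [netSum, relu_zero] at ih ⊢
  set A := (s.1.map φ).sum - (s.2.map φ).sum with hA
  have hAn : A none = 0 := by
    simp only [hA, Pi.sub_apply, hsum]
    simp [y, h0]
  have hAs : A (some ⟨s, hs⟩) = netSum s.1 (z ⟨s, hs⟩) - netSum s.2 (z ⟨s, hs⟩) := by
    simp only [hA, Pi.sub_apply, hsum]
    rfl
  have b1 := fun k => le_ciSup (Set.finite_range A).bddAbove k
  have b2 := fun k => le_ciSup (Set.finite_range fun i => -A i).bddAbove k
  have c1 := b1 none
  have c2 := b1 (some ⟨s, hs⟩)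
  have c3 := b2 none
  have c4 := b2 (some ⟨s, hs⟩)
  have h5 := (hz ⟨s, hs⟩).2
  rw [← hAs] at h5
  unfold spread at h4
  rw [hAn] at c1 c3
  rcases abs_cases (A (some ⟨s, hs⟩)) with ⟨h6, _⟩ | ⟨h6, _⟩ <;> linarith

/-- Keeping one half and doubling its weight changes the sum exactly by the difference of the two
halves; the shorter half is kept. -/
theorem exists_halving (L : List (ℝ × F)) (hL : UnitWeights L) {R : ℝ} (hR : 0 ≤ R) {K : ℕ}
    (hK : 1 ≤ K) (hlen : L.length ≤ 2 * K) :
    ∃ L' : List (ℝ × F), UnitWeights L' ∧ L'.length ≤ K ∧ ∀ z : F, ‖z‖ ≤ R →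
      |netSum L z / (2 * K : ℕ) - netSum L' z / K| ≤ 2 * R / Real.sqrt (2 * K : ℕ) := by
  obtain ⟨s, hs, h⟩ := exists_mem_splits_abs_sub_le L hL hR
  have hlen' := length_add_length_of_mem_splits hs
  have hmem := mem_of_mem_splits hs
  have hsum : ∀ z, netSum s.1 z + netSum s.2 z = netSum L z := fun z => sum_map_of_mem_splits _ hs
  have hK' : (0 : ℝ) < K := by exact_mod_cast hK
  have hbound : ∀ z : F, ‖z‖ ≤ R →
      |(netSum s.1 z - netSum s.2 z) / (2 * K : ℕ)| ≤ 2 * R / Real.sqrt (2 * K : ℕ) := by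
    intro z hz
    rw [abs_div, Nat.abs_cast, div_le_div_iff₀ (by positivity) (by positivity)]
    have h1 : Real.sqrt L.length ≤ Real.sqrt (2 * K : ℕ) := Real.sqrt_le_sqrt (by exact_mod_cast hlen)
    have h2 := Real.mul_self_sqrt (Nat.cast_nonneg (α := ℝ) (2 * K))
    calc |netSum s.1 z - netSum s.2 z| * Real.sqrt (2 * K : ℕ)
        ≤ 2 * R * Real.sqrt L.length * Real.sqrt (2 * K : ℕ) :=
          mul_le_mul_of_nonneg_right (h z hz) (Real.sqrt_nonneg _)
      _ ≤ 2 * R * Real.sqrt (2 * K : ℕ) * Real.sqrt (2 * K : ℕ) := by gcongr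
      _ = 2 * R * (2 * K : ℕ) := by rw [mul_assoc, h2]
  rcases le_total s.1.length s.2.length with hle | hle
  · refine ⟨s.1, fun q hq => hL q (hmem.1 q hq), by omega, fun z hz => ?_⟩
    have := hbound z hz
    rw [← hsum, ← abs_neg]
    convert this using 2
    push_cast
    field_simp
    ring
  · refine ⟨s.2, fun q hq => hL q (hmem.2 q hq), by omega, fun z hz => ?_⟩
    have := hbound z hz
    rw [← hsum]
    convert this using 2
    push_cast
    field_simp
    ring

/-- The halving errors form a geometric series with ratio `1/√2`, dominated by the last step, so the
bound does not depend on the initial length. -/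
theorem exists_reduction (R : ℝ) (hR : 0 ≤ R) {K : ℕ} (hK : 1 ≤ K) (j : ℕ) (L : List (ℝ × F))
    (hL : UnitWeights L) (hlen : L.length ≤ 2 ^ j * K) :
    ∃ L' : List (ℝ × F), UnitWeights L' ∧ L'.length ≤ K ∧ ∀ z : F, ‖z‖ ≤ R →
      |netSum L z / (2 ^ j * K : ℕ) - netSum L' z / K| ≤
        5 * R / Real.sqrt K * (1 - (1 / Real.sqrt 2) ^ j) := by
  induction j generalizing L with
  | zero => exact ⟨L, hL, by simpa using hlen, fun z _ => by simp⟩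
  | succ j ih =>
    obtain ⟨L₁, h1, h2, h3⟩ := exists_halving L hL hR (K := 2 ^ j * K)
      (Nat.mul_pos (by positivity) hK) (by rw [← mul_assoc, ← pow_succ']; exact hlen)
    obtain ⟨L₂, h4, h5, h6⟩ := ih L₁ h1 h2
    refine ⟨L₂, h4, h5, fun z hz => ?_⟩
    have e1 := h3 z hz
    have e2 := h6 z hz
    rw [← mul_assoc, ← pow_succ'] at e1
    refine (abs_sub_le _ _ _).trans ((add_le_add e1 e2).trans ?_)
    have hs : Real.sqrt (2 ^ (j + 1) * K : ℕ) = Real.sqrt 2 ^ (j + 1) * Real.sqrt K := by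
      push_cast
      rw [Real.sqrt_mul (by positivity)]
      congr 1
      rw [Real.sqrt_eq_iff_mul_self_eq (by positivity) (by positivity), ← mul_pow,
        Real.mul_self_sqrt (by norm_num)]
    have hK' : (0 : ℝ) < Real.sqrt K := Real.sqrt_pos.2 (by exact_mod_cast hK)
    have h2' : (0 : ℝ) < Real.sqrt 2 := by positivity
    have hle : 1 / Real.sqrt 2 ≤ 5 / 7 := by
      rw [div_le_div_iff₀ h2' (by norm_num)]
      have : (1.4 : ℝ) ≤ Real.sqrt 2 := Real.le_sqrt_of_sq_le (by norm_num)
      linarith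
    set r := 1 / Real.sqrt 2 with hr
    have hr0 : 0 ≤ r := by positivity
    have : 2 * R / (Real.sqrt 2 ^ (j + 1) * Real.sqrt K) = R / Real.sqrt K * (2 * (r ^ j * r)) := by
      rw [← pow_succ, hr, div_pow, one_pow]
      field_simp
    rw [hs, this, pow_succ]
    have hRK : 0 ≤ R / Real.sqrt K := by positivity
    have hrj : 0 ≤ r ^ j := by positivity
    have : 5 * R / Real.sqrt K = R / Real.sqrt K * 5 := by ring
    rw [this]
    -- This amounts to `7 r ≤ 5`, the reason for the constant 5.
    have key : 2 * (r ^ j * r) + 5 * (1 - r ^ j) ≤ 5 * (1 - r ^ j * r) := by nlinarith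
    calc _ = R / Real.sqrt K * (2 * (r ^ j * r) + 5 * (1 - r ^ j)) := by ring
      _ ≤ R / Real.sqrt K * (5 * (1 - r ^ j * r)) := by gcongr
      _ = _ := by ring

end Halving

/-! ### Sampling of Barron functions -/

section Sampling

variable {F : Type*} [NormedAddCommGroup F] [InnerProductSpace ℝ F]

theorem abs_netSum_le (L : List (ℝ × F)) (hL : UnitWeights L) {R : ℝ} {z : F} (hz : ‖z‖ ≤ R) :
    |netSum L z| ≤ L.length * R := by
  induction L with
  | nil => simp [netSum]
  | cons q L ih =>
    have h1 := ih fun q hq => hL q (List.mem_cons_of_mem _ hq)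
    have h2 := hL q List.mem_cons_self
    have h3 : |q.1 * relu (inner ℝ q.2 z)| ≤ R := by
      rw [abs_mul, abs_of_nonneg (relu_nonneg _)]
      have h4 := (relu_le_abs _).trans (abs_real_inner_le_norm q.2 z)
      have h5 : ‖q.2‖ * ‖z‖ ≤ 1 * R := mul_le_mul h2.2 hz (norm_nonneg _) zero_le_one
      have := relu_nonneg (inner ℝ q.2 z)
      nlinarith [h2.1, abs_nonneg q.1]
    simp only [netSum, List.map_cons, List.sum_cons, List.length_cons, Nat.cast_add, Nat.cast_one]
      at h1 ⊢
    refine (abs_add_le _ _).trans ?_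
    linarith

theorem netSum_append (L L' : List (ℝ × F)) (z : F) :
    netSum (L ++ L') z = netSum L z + netSum L' z := by
  simp [netSum]

theorem netSum_replicate (n : ℕ) (q : ℝ × F) (z : F) :
    netSum (List.replicate n q) z = n * (q.1 * relu (inner ℝ q.2 z)) := by
  simp [netSum]

/-- Neuron `i` is repeated `⌊c i * n⌋` times; each floor costs at most `R / n`. The number of
neurons may be huge, since `n` is arbitrarily large and the list is halved afterwards. -/
theorem exists_equal_weights {α : Type*} (s : Finset α) (c : α → ℝ) (hc : ∀ i ∈ s, 0 ≤ c i)
    (η : α → ℝ) (w : α → F) (hη : ∀ i ∈ s, |η i| ≤ 1) (hw : ∀ i ∈ s, ‖w i‖ ≤ 1) {R : ℝ}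
    {n : ℕ} (hn : 1 ≤ n) :
    ∃ L : List (ℝ × F), UnitWeights L ∧ (L.length : ℝ) ≤ (∑ i ∈ s, c i) * n ∧ ∀ z : F, ‖z‖ ≤ R →
      |(∑ i ∈ s, c i * (η i * relu (inner ℝ (w i) z))) - netSum L z / n| ≤ s.card * R / n := by
  classical
  have hn' : (0 : ℝ) < n := by exact_mod_cast hn
  induction s using Finset.induction_on with
  | empty => exact ⟨[], by simp [UnitWeights], by simp, by simp [netSum]⟩
  | insert i s his ih =>
    obtain ⟨L, h1, h2, h3⟩ := ih (fun j hj => hc j (Finset.mem_insert_of_mem hj))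
      (fun j hj => hη j (Finset.mem_insert_of_mem hj))
      (fun j hj => hw j (Finset.mem_insert_of_mem hj))
    have hci := hc i (Finset.mem_insert_self i s)
    have hηi := hη i (Finset.mem_insert_self i s)
    have hwi := hw i (Finset.mem_insert_self i s)
    have hfl := Nat.floor_le (mul_nonneg hci hn'.le)
    have hfl' := Nat.lt_floor_add_one (c i * n)
    have hq : UnitWeights [(η i, w i)] := by simp [UnitWeights, hηi, hwi]
    refine ⟨List.replicate ⌊c i * n⌋₊ (η i, w i) ++ L, ?_, ?_, ?_⟩
    · intro q hq
      rcases List.mem_append.1 hq with hq | hq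
      · rw [List.eq_of_mem_replicate hq]; exact ⟨hηi, hwi⟩
      · exact h1 q hq
    · rw [Finset.sum_insert his, List.length_append, List.length_replicate]
      push_cast
      linarith
    · intro z hz
      have h4 := h3 z hz
      have h5 := abs_netSum_le _ hq hz
      simp only [netSum, List.map_cons, List.map_nil, List.sum_cons, List.sum_nil, add_zero,
        List.length_cons, List.length_nil, zero_add, Nat.cast_one, one_mul] at h5
      rw [Finset.sum_insert his, netSum_append, netSum_replicate, Finset.card_insert_of_notMem his]
      set v := η i * relu (inner ℝ (w i) z)
      have e : c i * v + (∑ j ∈ s, c j * (η j * relu (inner ℝ (w j) z))) -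
          (⌊c i * n⌋₊ * v + netSum L z) / n =
          (c i * n - ⌊c i * n⌋₊) / n * v +
            ((∑ j ∈ s, c j * (η j * relu (inner ℝ (w j) z))) - netSum L z / n) := by
        field_simp
        ring
      have h6 : |(c i * n - ⌊c i * n⌋₊) / n * v| ≤ R / n := by
        rw [abs_mul, abs_div, abs_of_nonneg (sub_nonneg.2 hfl), abs_of_pos hn', div_mul_eq_mul_div]
        apply div_le_div_of_nonneg_right _ hn'.le
        nlinarith [abs_nonneg v]
      rw [e]
      refine (abs_add_le _ _).trans ((add_le_add h6 h4).trans (le_of_eq ?_))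
      push_cast
      ring

/-- The neuron with weight `w` as a continuous function on a ball. -/
def neuron (R : ℝ) (w : F) : C(Metric.closedBall (0 : F) R, ℝ) :=
  ⟨fun z => relu (inner ℝ w z.1),
    continuous_relu.comp (continuous_const.inner continuous_subtype_val)⟩

theorem continuous_neuron (R : ℝ) : Continuous (neuron (F := F) R) := by
  have : Continuous fun p : F × Metric.closedBall (0 : F) R => relu (inner ℝ p.1 p.2.1) :=
    continuous_relu.comp (continuous_fst.inner (continuous_subtype_val.comp continuous_snd))
  exact (ContinuousMap.curry ⟨_, this⟩).continuous

/-- The neurons with weights of norm at most one. -/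
def unitNeurons (F : Type*) [NormedAddCommGroup F] [InnerProductSpace ℝ F] (R : ℝ) :
    Set C(Metric.closedBall (0 : F) R, ℝ) :=
  {g | ∃ (η : ℝ) (w : F), |η| ≤ 1 ∧ ‖w‖ ≤ 1 ∧ g = η • neuron R w}

theorem zero_mem_unitNeurons (R : ℝ) : 0 ∈ unitNeurons F R :=
  ⟨0, 0, by simp, by simp, by simp⟩

theorem exists_net_of_mem_closure [FiniteDimensional ℝ F] {R : ℝ} (hR : 0 ≤ R)
    {f : C(Metric.closedBall (0 : F) R, ℝ)}
    (hf : f ∈ closure (convexHull ℝ (unitNeurons F R))) {ε : ℝ} (hε : 0 < ε) {K : ℕ} (hK : 1 ≤ K) :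
    ∃ L : List (ℝ × F), UnitWeights L ∧ L.length ≤ K ∧ ∀ z : Metric.closedBall (0 : F) R,
      |f z - netSum L z.1 / K| ≤ 5 * R / Real.sqrt K + ε := by
  obtain ⟨g, hg, hfg⟩ := Metric.mem_closure_iff.1 hf (ε / 2) (by positivity)
  rw [mem_convexHull_iff_exists_fintype] at hg
  obtain ⟨α, _, c, y, hc, hc1, hy, hsum⟩ := hg
  choose η w hη hw hyw using hy
  -- Enough doublings of `K` make the floor error at most `ε / 2`.
  obtain ⟨j, hj⟩ := pow_unbounded_of_one_lt ((Fintype.card α : ℝ) * R / (ε / 2)) (one_lt_two (α := ℝ))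
  have hK' : (1 : ℝ) ≤ K := by exact_mod_cast hK
  have hn : 1 ≤ 2 ^ j * K := Nat.mul_pos (by positivity) hK
  obtain ⟨L, h1, h2, h3⟩ := exists_equal_weights Finset.univ c (fun i _ => hc i) η w
    (fun i _ => hη i) (fun i _ => hw i) (R := R) hn
  rw [hc1, one_mul] at h2
  obtain ⟨L', h4, h5, h6⟩ := exists_reduction R hR hK j L h1 (by exact_mod_cast h2)
  refine ⟨L', h4, h5, fun z => ?_⟩
  have hz : ‖z.1‖ ≤ R := mem_closedBall_zero_iff.1 z.2
  have e1 : |f z - g z| ≤ ε / 2 := by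
    have := (ContinuousMap.dist_apply_le_dist (f := f) (g := g) z).trans hfg.le
    rwa [Real.dist_eq] at this
  have e2 : |g z - netSum L z.1 / (2 ^ j * K : ℕ)| ≤ ε / 2 := by
    have e3 : g z = ∑ i, c i * (η i * relu (inner ℝ (w i) z.1)) := by
      rw [← hsum]
      simp [hyw, neuron]
    rw [e3]
    refine (h3 z.1 hz).trans ?_
    rw [Finset.card_univ, div_le_iff₀ (by exact_mod_cast hn)]
    rw [div_lt_iff₀ (by positivity)] at hj
    push_cast
    have : (2 : ℝ) ^ j * (ε / 2) ≤ 2 ^ j * (ε / 2) * K := le_mul_of_one_le_right (by positivity) hK'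
    linarith
  have e4 := h6 z.1 hz
  have e5 : 5 * R / Real.sqrt K * (1 - (1 / Real.sqrt 2) ^ j) ≤ 5 * R / Real.sqrt K := by
    apply mul_le_of_le_one_right (by positivity)
    have : 0 ≤ (1 / Real.sqrt 2) ^ j := by positivity
    linarith
  calc |f z - netSum L' z.1 / K| ≤ |f z - g z| + (|g z - netSum L z.1 / (2 ^ j * K : ℕ)| +
        |netSum L z.1 / (2 ^ j * K : ℕ) - netSum L' z.1 / K|) := by
        refine (abs_sub_le _ (g z) _).trans (add_le_add le_rfl (abs_sub_le _ _ _))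
    _ ≤ _ := by linarith

end Sampling

/-! ### Barron functions as limits of convex combinations of unit neurons -/

section Barron

variable {ι : Type*} [Fintype ι]

/-- The scalar two-layer ReLU network given by a list of neurons `(a, b, c)`. -/
def listNet (L : List (ℝ × (ι → ℝ) × ℝ)) (x : ι → ℝ) : ℝ :=
  (L.map fun q => q.1 * relu (q.2.1 ⬝ᵥ x + q.2.2)).sum

/-- A point with an additional coordinate one. -/
def augPoint (x : ι → ℝ) : EuclideanSpace ℝ (Option ι) := WithLp.toLp 2 fun o => o.elim 1 x

/-- The weight and the bias of a neuron as one vector. -/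
def augWeight (b : ι → ℝ) (c : ℝ) : EuclideanSpace ℝ (Option ι) := WithLp.toLp 2 fun o => o.elim c b

theorem inner_augPoint (w : EuclideanSpace ℝ (Option ι)) (x : ι → ℝ) :
    inner ℝ w (augPoint x) = (fun i => w (some i)) ⬝ᵥ x + w none := by
  simp only [PiLp.inner_apply, Fintype.sum_option, augPoint, dotProduct]
  simp [mul_comm, add_comm]

theorem inner_augWeight_augPoint (b : ι → ℝ) (c : ℝ) (x : ι → ℝ) :
    inner ℝ (augWeight b c) (augPoint x) = b ⬝ᵥ x + c := inner_augPoint _ _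

theorem norm_augPoint_sq (x : EuclideanSpace ℝ ι) : ‖augPoint x.ofLp‖ ^ 2 = ‖x‖ ^ 2 + 1 := by
  simp only [EuclideanSpace.norm_sq_eq, Fintype.sum_option, augPoint]
  simp [add_comm]

theorem norm_augWeight_le (b : ι → ℝ) (c : ℝ) : ‖augWeight b c‖ ≤ (∑ i, |b i|) + |c| := by
  have hb : 0 ≤ ∑ i, |b i| := Finset.sum_nonneg fun i _ => abs_nonneg _
  apply le_of_sq_le_sq _ (by positivity)
  have : ∑ i, |b i| ^ 2 ≤ (∑ i, |b i|) ^ 2 :=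
    Finset.sum_sq_le_sq_sum_of_nonneg fun i _ => abs_nonneg _
  simp only [EuclideanSpace.norm_sq_eq, Fintype.sum_option, augWeight]
  simp only [Option.elim, Real.norm_eq_abs]
  nlinarith [abs_nonneg c]

/-- The integrand in the definition of the Barron norm. -/
def barronWeight (θ : ℝ × (ι → ℝ) × ℝ) : ℝ := |θ.1| * ((∑ i, |θ.2.1 i|) + |θ.2.2|)

theorem barronWeight_nonneg (θ : ℝ × (ι → ℝ) × ℝ) : 0 ≤ barronWeight θ := by
  unfold barronWeight
  have : 0 ≤ ∑ i, |θ.2.1 i| := Finset.sum_nonneg fun i _ => abs_nonneg _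
  positivity

theorem continuous_barronWeight : Continuous (barronWeight (ι := ι)) := by
  unfold barronWeight
  fun_prop

/-- The neuron `a σ(b ⬝ x + c)` as a continuous function of the augmented point. -/
def paramNeuron (R : ℝ) (θ : ℝ × (ι → ℝ) × ℝ) :
    C(Metric.closedBall (0 : EuclideanSpace ℝ (Option ι)) R, ℝ) :=
  θ.1 • neuron R (augWeight θ.2.1 θ.2.2)

theorem continuous_paramNeuron (R : ℝ) : Continuous (paramNeuron (ι := ι) R) := by
  have : Continuous fun θ : ℝ × (ι → ℝ) × ℝ => augWeight θ.2.1 θ.2.2 := by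
    unfold augWeight
    apply (PiLp.continuous_toLp 2 _).comp
    refine continuous_pi fun o => ?_
    cases o
    · exact continuous_snd.snd
    · exact (continuous_apply _).comp continuous_snd.fst
  exact continuous_fst.smul ((continuous_neuron R).comp this)

/-- Positive homogeneity of the ReLU moves the size of the inner weight to the outside; the
Euclidean norm of the weight is at most its `ℓ¹` norm. -/
theorem exists_smul_unitNeurons (R : ℝ) (θ : ℝ × (ι → ℝ) × ℝ) :
    ∃ g ∈ unitNeurons (EuclideanSpace ℝ (Option ι)) R, paramNeuron R θ = barronWeight θ • g := by
  set n := (∑ i, |θ.2.1 i|) + |θ.2.2| with hn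
  have hb : 0 ≤ ∑ i, |θ.2.1 i| := Finset.sum_nonneg fun i _ => abs_nonneg _
  have hn0 : 0 ≤ n := by positivity
  have hw := norm_augWeight_le θ.2.1 θ.2.2
  rw [← hn] at hw
  rcases hn0.eq_or_lt with h0 | h0
  · refine ⟨0, zero_mem_unitNeurons R, ?_⟩
    have : augWeight θ.2.1 θ.2.2 = 0 := norm_le_zero_iff.1 (h0 ▸ hw)
    ext z
    simp [paramNeuron, neuron, this, relu_zero]
  · refine ⟨(SignType.sign θ.1 : ℝ) • neuron R (n⁻¹ • augWeight θ.2.1 θ.2.2),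
      ⟨SignType.sign θ.1, _, ?_, ?_, rfl⟩, ?_⟩
    · rcases lt_trichotomy θ.1 0 with h | h | h <;> simp [h]
    · rw [norm_smul, norm_inv, Real.norm_of_nonneg hn0, inv_mul_le_iff₀ h0, mul_one]
      exact hw
    · ext z
      have : relu (inner ℝ (n⁻¹ • augWeight θ.2.1 θ.2.2) z.1) =
          n⁻¹ * relu (inner ℝ (augWeight θ.2.1 θ.2.2) z.1) := by
        rw [real_inner_smul_left, relu_mul_of_nonneg (by positivity)]
      have hs : |θ.1| * (SignType.sign θ.1 : ℝ) = θ.1 := by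
        rw [mul_comm]; exact sign_mul_abs θ.1
      simp only [paramNeuron, neuron, barronWeight, ← hn, ContinuousMap.smul_apply,
        ContinuousMap.coe_mk, smul_eq_mul, this]
      calc _ = (|θ.1| * (SignType.sign θ.1 : ℝ)) * relu (inner ℝ (augWeight θ.2.1 θ.2.2) z.1) := by
            rw [hs]
        _ = _ := by field_simp

theorem norm_unitNeurons_le {R : ℝ} (hR : 0 ≤ R)
    {g : C(Metric.closedBall (0 : EuclideanSpace ℝ (Option ι)) R, ℝ)}
    (hg : g ∈ unitNeurons (EuclideanSpace ℝ (Option ι)) R) : ‖g‖ ≤ R := by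
  obtain ⟨η, w, hη, hw, rfl⟩ := hg
  rw [ContinuousMap.norm_le _ hR]
  intro z
  have h := abs_netSum_le [(η, w)] (by simp [UnitWeights, hη, hw]) (mem_closedBall_zero_iff.1 z.2)
  simpa [netSum, neuron] using h

theorem integrable_barronWeight {p : ℝ≥0∞} (hp : 1 ≤ p) {ρ : Measure (ℝ × (ι → ℝ) × ℝ)}
    [IsProbabilityMeasure ρ] {V : ℝ} (hV : 0 ≤ V)
    (h : eLpNorm (barronWeight (ι := ι)) p ρ ≤ ENNReal.ofReal V) :
    Integrable barronWeight ρ ∧ ∫ θ, barronWeight θ ∂ρ ≤ V := by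
  have hm : AEStronglyMeasurable (barronWeight (ι := ι)) ρ :=
    continuous_barronWeight.aestronglyMeasurable
  have h1 : eLpNorm (barronWeight (ι := ι)) 1 ρ ≤ ENNReal.ofReal V :=
    (eLpNorm_le_eLpNorm_of_exponent_le hp hm).trans h
  have hi : Integrable barronWeight ρ :=
    memLp_one_iff_integrable.1 ⟨hm, h1.trans_lt ENNReal.ofReal_lt_top⟩
  refine ⟨hi, ?_⟩
  rw [eLpNorm_one_eq_lintegral_enorm, ← ofReal_integral_norm_eq_lintegral_enorm hi,
    ENNReal.ofReal_le_ofReal_iff hV] at h1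
  simpa [Real.norm_of_nonneg (barronWeight_nonneg _)] using h1

theorem exists_law_of_barronNorm_lt {p : ℝ≥0∞} (hp : 1 ≤ p) {U : Set (EuclideanSpace ℝ ι)}
    {f : EuclideanSpace ℝ ι → ℝ} {V : ℝ} (h : barronNorm p U f < ENNReal.ofReal V) :
    ∃ ρ : Measure (ℝ × (ι → ℝ) × ℝ), IsProbabilityMeasure ρ ∧
      (∀ x ∈ U, f x = ∫ θ, θ.1 * relu (θ.2.1 ⬝ᵥ x.ofLp + θ.2.2) ∂ρ) ∧
      Integrable barronWeight ρ ∧ ∫ θ, barronWeight θ ∂ρ ≤ V := by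
  unfold barronNorm at h
  simp only [iInf_lt_iff, Set.mem_ofPred_eq] at h
  obtain ⟨ρ, ⟨h1, h2⟩, h3⟩ := h
  have hV : 0 ≤ V := by
    by_contra hV
    rw [ENNReal.ofReal_of_nonpos (not_le.1 hV).le] at h3
    exact not_lt_zero h3
  exact ⟨ρ, h1, h2, integrable_barronWeight hp hV h3.le⟩

theorem abs_neuron_le_barronWeight (θ : ℝ × (ι → ℝ) × ℝ) {x : ι → ℝ} (hx : ∀ i, |x i| ≤ 1) :
    |θ.1 * relu (θ.2.1 ⬝ᵥ x + θ.2.2)| ≤ barronWeight θ := by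
  rw [abs_mul, abs_of_nonneg (relu_nonneg _), barronWeight]
  apply mul_le_mul_of_nonneg_left _ (abs_nonneg _)
  refine (relu_le_abs _).trans ((abs_add_le _ _).trans (add_le_add ?_ le_rfl))
  refine (Finset.abs_sum_le_sum_abs _ _).trans (Finset.sum_le_sum fun i _ => ?_)
  rw [abs_mul]
  exact mul_le_of_le_one_right (abs_nonneg _) (hx i)

theorem abs_le_barronNorm {p : ℝ≥0∞} (hp : 1 ≤ p) {U : Set (EuclideanSpace ℝ ι)}
    {f : EuclideanSpace ℝ ι → ℝ} (hfin : barronNorm p U f ≠ ∞) {x : EuclideanSpace ℝ ι}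
    (hx : x ∈ U) (hx1 : ∀ i, |x i| ≤ 1) : |f x| ≤ (barronNorm p U f).toReal := by
  apply le_of_forall_gt_imp_ge_of_dense
  intro V hV
  obtain ⟨ρ, _, h1, h2, h3⟩ := exists_law_of_barronNorm_lt hp
    ((ENNReal.lt_ofReal_iff_toReal_lt hfin).2 hV)
  rw [h1 x hx]
  refine le_trans ?_ h3
  rw [← Real.norm_eq_abs]
  exact norm_integral_le_of_norm_le h2 (Filter.Eventually.of_forall fun θ =>
    abs_neuron_le_barronWeight θ hx1)

/-- The representation becomes a Bochner integral of neurons in the space of continuous functions on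
the ball. A functional that separates it from the hull would be below `u` on unit neurons, hence at
most `V u` on the integral. -/
theorem barron_mem_closure {p : ℝ≥0∞} (hp : 1 ≤ p) {U : Set (EuclideanSpace ℝ ι)}
    {f : EuclideanSpace ℝ ι → ℝ} {R V : ℝ} (hR : 0 ≤ R) (hV : 0 < V)
    (hU : ∀ x ∈ U, ‖augPoint x.ofLp‖ ≤ R) (h : barronNorm p U f < ENNReal.ofReal V) :
    ∃ g ∈ closure (convexHull ℝ (unitNeurons (EuclideanSpace ℝ (Option ι)) R)),
      ∀ x (hx : x ∈ U), f x = V * g ⟨augPoint x.ofLp, by simpa using hU x hx⟩ := by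
  obtain ⟨ρ, _, h1, h2, h3⟩ := exists_law_of_barronNorm_lt hp h
  have hGm : AEStronglyMeasurable (paramNeuron (ι := ι) R) ρ :=
    (continuous_paramNeuron R).aestronglyMeasurable
  have hGi : Integrable (paramNeuron (ι := ι) R) ρ := by
    refine (h2.const_mul R).mono' hGm (Filter.Eventually.of_forall fun θ => ?_)
    obtain ⟨g, hg, hθ⟩ := exists_smul_unitNeurons R θ
    rw [hθ, norm_smul, Real.norm_of_nonneg (barronWeight_nonneg θ), mul_comm]
    exact mul_le_mul_of_nonneg_right (norm_unitNeurons_le hR hg) (barronWeight_nonneg θ)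
  refine ⟨V⁻¹ • ∫ θ, paramNeuron R θ ∂ρ, ?_, ?_⟩
  · by_contra hcon
    obtain ⟨ℓ, u, hu, hℓ⟩ := geometric_hahn_banach_closed_point
      (convex_convexHull ℝ _).closure isClosed_closure hcon
    have hmem : ∀ g ∈ unitNeurons (EuclideanSpace ℝ (Option ι)) R, ℓ g < u := fun g hg =>
      hu g (subset_closure (subset_convexHull ℝ _ hg))
    -- Zero lies in the hull, so `u` is positive and a total weight smaller than `V` does no harm.
    have hu0 : 0 < u := by simpa using hmem 0 (zero_mem_unitNeurons R)
    rw [map_smul, ← ContinuousLinearMap.integral_comp_comm ℓ hGi, smul_eq_mul,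
      lt_inv_mul_iff₀ hV] at hℓ
    have h4 : ∫ θ, ℓ (paramNeuron R θ) ∂ρ ≤ ∫ θ, barronWeight θ * u ∂ρ := by
      refine integral_mono (ℓ.integrable_comp hGi) (h2.mul_const u) fun θ => ?_
      obtain ⟨g, hg, hθ⟩ := exists_smul_unitNeurons R θ
      simp only [hθ, map_smul, smul_eq_mul]
      exact mul_le_mul_of_nonneg_left (hmem g hg).le (barronWeight_nonneg θ)
    rw [integral_mul_const] at h4
    nlinarith
  · intro x hx
    rw [h1 x hx, ContinuousMap.smul_apply, ContinuousMap.integral_apply hGi, smul_eq_mul,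
      mul_inv_cancel_left₀ hV.ne']
    simp [paramNeuron, neuron, inner_augWeight_augPoint]

theorem exists_listNet_approx {p : ℝ≥0∞} (hp : 1 ≤ p) {U : Set (EuclideanSpace ℝ ι)}
    {f : EuclideanSpace ℝ ι → ℝ} (hfin : barronNorm p U f ≠ ∞) {r : ℝ}
    (hU : ∀ x ∈ U, ‖x‖ ^ 2 ≤ r) (hU1 : ∀ x ∈ U, ∀ i, |x i| ≤ 1) (hr : 0 ≤ r) {K : ℕ}
    (hK : 1 ≤ K) :
    ∃ L : List (ℝ × (ι → ℝ) × ℝ), L.length ≤ K ∧ ∀ x ∈ U,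
      |f x - listNet L x.ofLp| ≤ 7 * Real.sqrt (r + 1) * (barronNorm p U f).toReal / Real.sqrt K := by
  set N := (barronNorm p U f).toReal with hN
  have hN0 : 0 ≤ N := ENNReal.toReal_nonneg
  rcases hN0.eq_or_lt with h0 | h0
  · refine ⟨[], by simp, fun x hx => ?_⟩
    have := abs_le_barronNorm hp hfin hx (hU1 x hx)
    rw [← hN, ← h0] at this
    simpa [← h0, listNet] using this
  set R := Real.sqrt (r + 1) with hR
  have hR0 : 0 < R := Real.sqrt_pos.2 (by linarith)
  have hK0 : 0 < Real.sqrt K := Real.sqrt_pos.2 (by exact_mod_cast hK)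
  have hR' : ∀ x ∈ U, ‖augPoint x.ofLp‖ ≤ R := fun x hx => by
    apply Real.le_sqrt_of_sq_le
    rw [norm_augPoint_sq]
    linarith [hU x hx]
  -- The infimum need not be attained, so `V` exceeds the norm slightly; the final constant is `7/6
  -- * (5 + 1) = 7`.
  set V := 7 / 6 * N with hVd
  have hV : 0 < V := by positivity
  obtain ⟨g, hg, hfg⟩ := barron_mem_closure hp hR0.le hV hR'
    ((ENNReal.lt_ofReal_iff_toReal_lt hfin).2 (by rw [← hN]; linarith))
  obtain ⟨L, hL, hlen, hL'⟩ := exists_net_of_mem_closure hR0.le hg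
    (ε := R / Real.sqrt K) (by positivity) hK
  refine ⟨L.map fun q => (V * q.1 / K, fun i => q.2 (some i), q.2 none), by simpa using hlen, ?_⟩
  intro x hx
  have h1 := hL' ⟨augPoint x.ofLp, by simpa using hR' x hx⟩
  have h2 : listNet (L.map fun q => (V * q.1 / K, (fun i => q.2 (some i)), q.2 none)) x.ofLp =
      V * (netSum L (augPoint x.ofLp) / K) := by
    clear hlen hL' h1 hL
    induction L with
    | nil => simp [listNet, netSum]
    | cons q L ih =>
      simp only [listNet, netSum, List.map_cons, List.sum_cons, inner_augPoint] at ih ⊢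
      rw [ih]
      ring
  rw [h2, hfg x hx, ← mul_sub, abs_mul, abs_of_pos hV]
  calc _ ≤ V * (5 * R / Real.sqrt K + R / Real.sqrt K) := mul_le_mul_of_nonneg_left h1 hV.le
    _ = 7 * R * N / Real.sqrt K := by rw [hVd]; ring

end Barron

/-! ### Attention kernels that select one position -/

section Kernel

open Polynomial

/-- The odd Chebyshev polynomial `T_{2N+1}` is divisible by `u`, bounded by 1 on `[-1, 1]`, and has
derivative `±(2N+1)` at 0. The quotient by `u`, normalized at 0, is the peak. -/
theorem exists_peak_polynomial (N : ℕ) :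
    ∃ q : ℝ[X], q.natDegree ≤ 2 * N ∧ q.eval 0 = 1 ∧
      ∀ u : ℝ, |u| ≤ 1 → (2 * N + 1) * |u| * |q.eval u| ≤ 1 := by
  set P : ℝ[X] := Chebyshev.T ℝ (2 * N + 1 : ℤ) with hP
  have hodd : Odd (2 * N + 1 : ℤ) := ⟨N, rfl⟩
  have h0 : P.coeff 0 = 0 := by
    rw [coeff_zero_eq_eval_zero]; exact Chebyshev.T_eval_zero_of_odd _ hodd
  have hdiv : P = P.divX * X := by
    conv_lhs => rw [← divX_mul_X_add P, h0, map_zero, add_zero]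
  have h1 : P.divX.eval 0 = (2 * N + 1) * ((N : ℤ).negOnePow : ℝ) := by
    have e1 : P.divX.eval 0 = (derivative P).eval 0 := by
      conv_rhs => rw [hdiv]
      simp [derivative_mul]
    rw [e1, hP, Chebyshev.T_derivative_eq_U, add_sub_cancel_right, eval_mul,
      Chebyshev.U_eval_zero_of_even _ (even_two_mul _)]
    simp
  have hs : |((N : ℤ).negOnePow : ℝ)| = 1 := by
    rcases Int.units_eq_one_or (N : ℤ).negOnePow with h | h <;> simp [h]
  set c := P.divX.eval 0 with hc
  have hN : (0 : ℝ) < 2 * N + 1 := by positivity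
  have hc0 : |c| = 2 * N + 1 := by rw [h1, abs_mul, hs, mul_one, abs_of_pos hN]
  have hcne : c ≠ 0 := abs_pos.1 (hc0 ▸ hN)
  refine ⟨C c⁻¹ * P.divX, ?_, ?_, fun u hu => ?_⟩
  · refine (natDegree_C_mul_le _ _).trans ?_
    rw [natDegree_divX_eq_natDegree_tsub_one, hP, Chebyshev.natDegree_T]
    omega
  · rw [eval_mul, eval_C, ← hc, inv_mul_cancel₀ hcne]
  · have h2 := Chebyshev.abs_eval_T_real_le_one (2 * N + 1) hu
    rw [← hP, hdiv, eval_mul, eval_X, abs_mul] at h2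
    rw [eval_mul, eval_C, abs_mul, abs_inv, hc0]
    calc _ = |eval u P.divX| * |u| := by field_simp
      _ ≤ 1 := h2

/-- The stored value for memory `t`: the number itself, or its logarithm. -/
def memVal (type : RPEType) (t : ℝ) : ℝ :=
  match type with
  | .lin => t
  | .log => Real.log t

/-- `e^{0.01 T}` for `lin`, and `T^{1.01}` for `log`. -/
def memScale (type : RPEType) (T : ℕ) : ℝ :=
  match type with
  | .lin => Real.exp (0.01 * T)
  | .log => (T : ℝ) ^ (1.01 : ℝ)

/-- The exponents for which the attention weights are summable. -/
def SummableExponent (type : RPEType) (p : ℝ) : Prop :=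
  match type with
  | .lin => 0 < p
  | .log => 1 < p

theorem SummableExponent.pos {type : RPEType} {p : ℝ} (h : SummableExponent type p) : 0 < p := by
  cases type
  · exact h
  · exact zero_lt_one.trans h

theorem attnWeight_nonneg (type : RPEType) (p q : ℝ) (s : ℕ) : 0 ≤ attnWeight type p q s := by
  cases type
  · exact (Real.exp_pos _).le
  · unfold attnWeight
    dsimp only
    split_ifs
    · exact le_rfl
    · exact (Real.exp_pos _).le

theorem attnWeight_eq_exp_mul (type : RPEType) (p q : ℝ) (s : ℕ) :
    attnWeight type p q s = Real.exp q * attnWeight type p 0 s := by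
  cases type
  · simp only [attnWeight]
    rw [← Real.exp_add]
    ring_nf
  · simp only [attnWeight]
    split_ifs
    · simp
    · rw [← Real.exp_add]
      ring_nf

theorem SummableExponent.summable {type : RPEType} {p : ℝ} (h : SummableExponent type p) (q : ℝ) :
    Summable (attnWeight type p q) := by
  have h0 : Summable (attnWeight type p 0) := by
    cases type
    · have hp : 0 < p := h
      have := Real.summable_exp_nat_mul_iff.2 (neg_lt_zero.2 hp)
      refine this.congr fun s => ?_
      simp only [attnWeight]
      ring_nf
    · have hp : 1 < p := h
      refine Summable.of_nonneg_of_le (attnWeight_nonneg _ _ _) (fun s => ?_)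
        (Real.summable_nat_rpow.2 (neg_lt_neg hp))
      simp only [attnWeight]
      split_ifs with hs
      · positivity
      · rw [Real.rpow_def_of_pos (by positivity)]
        apply le_of_eq
        ring_nf
  simpa only [← attnWeight_eq_exp_mul] using h0.mul_left (Real.exp q)

/-- The attention weight with the smallest exponent. -/
def baseWeight (type : RPEType) (t : ℝ) (s : ℕ) : ℝ :=
  attnWeight type 0.01 (0.01 * memVal type t) s

/-- Equally spaced exponents make the heads monomials in one variable. For `log`, the weight at
distance 0 vanishes, which is why `i ≠ 0` is required. -/
theorem attnWeight_eq_baseWeight_pow (type : RPEType) (t : ℝ) (s : ℕ) {i : ℕ} (hi : i ≠ 0) :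
    attnWeight type (0.01 * i) (0.01 * i * memVal type t) s = baseWeight type t s ^ i := by
  cases type
  · simp only [baseWeight, attnWeight]
    rw [← Real.exp_nat_mul]
    ring_nf
  · simp only [baseWeight, attnWeight]
    split_ifs
    · simp [hi]
    · rw [← Real.exp_nat_mul]
      ring_nf

theorem baseWeight_self (type : RPEType) {t : ℕ} (ht : 1 ≤ t) : baseWeight type t t = 1 := by
  cases type
  · simp [baseWeight, attnWeight, memVal]
  · simp [baseWeight, attnWeight, memVal]
    omega

/-- The maximum of the base weight over memories up to `T`. -/
def baseBound (type : RPEType) (T : ℕ) : ℝ := Real.exp (0.01 * memVal type T)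

theorem memVal_mono (type : RPEType) {t T : ℕ} (ht : 1 ≤ t) (hT : t ≤ T) :
    memVal type t ≤ memVal type T := by
  cases type
  · exact Nat.cast_le.2 hT
  · exact Real.log_le_log (by positivity) (Nat.cast_le.2 hT)

theorem memVal_nonneg (type : RPEType) (t : ℕ) : 0 ≤ memVal type t := by
  cases type
  · exact Nat.cast_nonneg _
  · exact Real.log_natCast_nonneg _

theorem one_le_baseBound (type : RPEType) (T : ℕ) : 1 ≤ baseBound type T :=
  Real.one_le_exp (mul_nonneg (by norm_num) (memVal_nonneg type T))

theorem baseWeight_le (type : RPEType) {t T : ℕ} (ht : 1 ≤ t) (hT : t ≤ T) (s : ℕ) :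
    baseWeight type t s ≤ baseBound type T := by
  have h := memVal_mono type ht hT
  cases type
  · simp only [baseWeight, attnWeight, baseBound]
    apply Real.exp_le_exp.2
    have : (0 : ℝ) ≤ s := Nat.cast_nonneg s
    linarith
  · simp only [baseWeight, attnWeight, baseBound]
    split_ifs
    · exact (Real.exp_pos _).le
    · apply Real.exp_le_exp.2
      have := Real.log_natCast_nonneg s
      linarith

theorem half_le_abs_exp_sub_one {x δ : ℝ} (hδ : 0 ≤ δ) (hδ1 : δ ≤ 1) (hx : δ ≤ |x|) :
    δ / 2 ≤ |Real.exp x - 1| := by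
  rcases le_total 0 x with h | h
  · rw [abs_of_nonneg h] at hx
    have := Real.add_one_le_exp x
    rw [abs_of_nonneg (by linarith)]
    linarith
  · rw [abs_of_nonpos h] at hx
    have h1 : Real.exp x ≤ Real.exp (-δ) := Real.exp_le_exp.2 (by linarith)
    have h2 := Real.add_one_le_exp δ
    have h3 : Real.exp (-δ) * Real.exp δ = 1 := by rw [← Real.exp_add]; simp
    have h4 : Real.exp (-δ) ≤ 1 - δ / 2 := by
      have h5 := Real.exp_pos (-δ)
      have h6 : Real.exp (-δ) * (δ + 1) ≤ 1 := by nlinarith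
      nlinarith
    rw [abs_of_nonpos (by linarith)]
    linarith

theorem inv_two_mul_le_abs_log_sub_log {s t T : ℕ} (hs : s ≠ 0) (ht : 1 ≤ t) (hT : t ≤ T)
    (hst : s ≠ t) : 1 / (2 * T : ℝ) ≤ |Real.log t - Real.log s| := by
  have hs' : (1 : ℝ) ≤ s := by exact_mod_cast Nat.one_le_iff_ne_zero.2 hs
  have ht' : (1 : ℝ) ≤ t := by exact_mod_cast ht
  have hT' : (t : ℝ) ≤ T := by exact_mod_cast hT
  rcases lt_or_gt_of_ne hst with h | h
  · have h' : (s : ℝ) + 1 ≤ t := by exact_mod_cast h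
    have h1 := Real.one_sub_inv_le_log_of_pos (x := (t : ℝ) / s) (by positivity)
    rw [Real.log_div (by linarith) (by linarith), inv_div] at h1
    refine le_trans ?_ (h1.trans (le_abs_self _))
    rw [one_sub_div (by linarith), div_le_div_iff₀ (by linarith) (by linarith)]
    nlinarith
  · have h' : (t : ℝ) + 1 ≤ s := by exact_mod_cast h
    have h1 := Real.one_sub_inv_le_log_of_pos (x := (s : ℝ) / t) (by positivity)
    rw [Real.log_div (by linarith) (by linarith), inv_div] at h1
    rw [abs_sub_comm]
    refine le_trans ?_ (h1.trans (le_abs_self _))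
    rw [one_sub_div (by linarith), div_le_div_iff₀ (by linarith) (by linarith)]
    nlinarith

theorem memScale_pos (type : RPEType) {T : ℕ} (hT : 1 ≤ T) : 1 ≤ memScale type T := by
  cases type
  · exact Real.one_le_exp (by positivity)
  · exact Real.one_le_rpow (by exact_mod_cast hT) (by norm_num)

/-- The relative gap between the peak value 1 and all other base weights. For `lin` the exponents
differ by at least `0.01`; for `log` distinct integers have logarithms at least `1/(2T)` apart,
which costs an extra factor `T`. -/
theorem baseBound_le_abs_sub_one (type : RPEType) {s t T : ℕ} (ht : 1 ≤ t) (hT : t ≤ T)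
    (hst : s ≠ t) :
    baseBound type T ≤ 400 * memScale type T * |baseWeight type t s - 1| := by
  cases type
  · simp only [baseWeight, attnWeight, baseBound, memVal, memScale]
    have h1 : (0.01 : ℝ) ≤ |0.01 * (t : ℝ) - 0.01 * s| := by
      rw [← mul_sub, abs_mul, abs_of_pos (by norm_num : (0 : ℝ) < 0.01)]
      have : (1 : ℝ) ≤ |(t : ℝ) - s| := by
        have : (1 : ℤ) ≤ |(t : ℤ) - s| := Int.one_le_abs (by omega)
        exact_mod_cast this
      linarith
    have h2 := half_le_abs_exp_sub_one (by norm_num) (by norm_num) h1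
    have h3 := Real.exp_pos (0.01 * (T : ℝ))
    nlinarith
  · have hT0 : (1 : ℝ) ≤ T := by exact_mod_cast ht.trans hT
    have h3 : baseBound .log T * T = memScale .log T := by
      simp only [baseBound, memVal, memScale]
      rw [Real.rpow_def_of_pos (by positivity)]
      nth_rw 2 [← Real.exp_log (by positivity : (0 : ℝ) < T)]
      rw [← Real.exp_add]
      ring_nf
    have h4 := one_le_baseBound .log T
    have key : 1 / (400 * T : ℝ) ≤ |baseWeight .log t s - 1| := by
      simp only [baseWeight, attnWeight, memVal]
      split_ifs with hs
      · rw [zero_sub, abs_neg, abs_one, div_le_one (by positivity)]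
        linarith
      · have h1 := inv_two_mul_le_abs_log_sub_log hs ht hT hst
        have e : (1 : ℝ) / (200 * T) = 0.01 * (1 / (2 * T)) := by field_simp; norm_num
        have h2 := half_le_abs_exp_sub_one (x := 0.01 * Real.log t - 0.01 * Real.log s)
          (δ := 1 / (200 * T)) (by positivity) ((div_le_one (by positivity)).2 (by linarith)) (by
            rw [← mul_sub, abs_mul, abs_of_pos (by norm_num : (0 : ℝ) < 0.01), e]
            exact mul_le_mul_of_nonneg_left h1 (by norm_num))
        refine le_trans (le_of_eq ?_) h2
        field_simp
        norm_num
    rw [div_le_iff₀ (by positivity)] at key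
    rw [← h3]
    nlinarith

/-- The smallest power of the base weight that is summable. -/
def basePower (type : RPEType) : ℕ :=
  match type with
  | .lin => 1
  | .log => 101

theorem basePower_ne_zero (type : RPEType) : basePower type ≠ 0 := by
  cases type <;> simp [basePower]

theorem summableExponent_of_basePower_le {type : RPEType} {i : ℕ} (hi : basePower type ≤ i) :
    SummableExponent type (0.01 * i) := by
  cases type
  · have : (1 : ℝ) ≤ i := by exact_mod_cast hi
    simp only [SummableExponent]
    linarith
  · have : (101 : ℝ) ≤ i := by exact_mod_cast hi
    simp only [SummableExponent]
    linarith

/-- A summable majorant of the weights. -/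
def kernelMajorant (type : RPEType) : ℕ → ℝ := attnWeight type (0.01 * basePower type) 0

theorem summable_kernelMajorant (type : RPEType) : Summable (kernelMajorant type) :=
  (summableExponent_of_basePower_le le_rfl).summable 0

theorem baseWeight_pow_le (type : RPEType) {t T : ℕ} (ht : 1 ≤ t) (hT : t ≤ T) (s : ℕ) :
    baseWeight type t s ^ basePower type ≤ memScale type T * kernelMajorant type s := by
  rw [← attnWeight_eq_baseWeight_pow _ _ _ (basePower_ne_zero type), attnWeight_eq_exp_mul,
    kernelMajorant]
  apply mul_le_mul_of_nonneg_right _ (attnWeight_nonneg _ _ _ _)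
  have h := memVal_mono type ht hT
  cases type
  · simp only [memScale, basePower, memVal] at h ⊢
    apply Real.exp_le_exp.2
    push_cast
    linarith
  · have hT0 : (0 : ℝ) < T := by exact_mod_cast ht.trans hT
    simp only [memScale, basePower, memVal] at h ⊢
    rw [Real.rpow_def_of_pos hT0]
    apply Real.exp_le_exp.2
    push_cast
    linarith

/-- The weight at distance `s` given by a combination of heads with coefficients `α` and exponents
`p`, for a stored memory value `μ`. -/
def headKernel {k : ℕ} (type : RPEType) (α p : Fin k → ℝ) (μ : ℝ) (s : ℕ) : ℝ :=
  ∑ i, α i * attnWeight type (p i) (p i * μ) s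

/-- The kernel is `x^b Q(x)` in the base weight `x`: the factor `x^b`, with `b` the base power,
supplies a summable majorant and one factor `memScale`, while the gap estimate makes `Q` small off
the peak and supplies the other `n` factors. -/
theorem exists_polynomial_kernel (type : RPEType) {n k N T : ℕ} (hk : 2 * N * n < k) (hT1 : 1 ≤ T) :
    ∃ α p : Fin k → ℝ, (∀ i, SummableExponent type (p i)) ∧ ∀ t : ℕ, 1 ≤ t → t ≤ T →
      headKernel type α p (memVal type t) t = 1 ∧ ∀ s ≠ t,
      |headKernel type α p (memVal type t) s| ≤
        kernelMajorant type s * (memScale type T * (400 * memScale type T / (2 * N + 1)) ^ n) := by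
  obtain ⟨q, hq1, hq2, hq3⟩ := exists_peak_polynomial N
  set B := baseBound type T with hB
  have hB1 : 1 ≤ B := one_le_baseBound type T
  have hE := memScale_pos type hT1
  -- Division by `B` maps `x - 1` into `[-1, 1]`, where the peak polynomial is controlled; its zero
  -- argument corresponds to `x = 1`.
  set Q : ℝ[X] := (q.comp (Polynomial.C B⁻¹ * (X - 1))) ^ n with hQ
  have hdeg : Q.natDegree < k := by
    refine lt_of_le_of_lt (natDegree_pow_le.trans ?_) hk
    rw [mul_comm n]
    apply Nat.mul_le_mul_right
    refine natDegree_comp_le.trans ?_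
    calc _ ≤ q.natDegree * 1 := by
          apply Nat.mul_le_mul_left
          refine (natDegree_C_mul_le _ _).trans ?_
          simpa using (natDegree_sub_le (X : ℝ[X]) 1)
      _ ≤ 2 * N := by simpa using hq1
  have hQe : ∀ x, Q.eval x = (q.eval (B⁻¹ * (x - 1))) ^ n := by
    intro x; simp [hQ]
  refine ⟨fun i => Q.coeff i, fun i => 0.01 * ((basePower type + i : ℕ) : ℝ),
    fun i => summableExponent_of_basePower_le (Nat.le_add_right _ _), ?_⟩
  have heq : ∀ t s : ℕ, headKernel type (fun i : Fin k => Q.coeff i)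
      (fun i => 0.01 * ((basePower type + i : ℕ) : ℝ)) (memVal type t) s =
      baseWeight type t s ^ basePower type * Q.eval (baseWeight type t s) := by
    intro t s
    rw [eval_eq_sum_range' hdeg, Finset.mul_sum, ← Fin.sum_univ_eq_sum_range
      (fun i => baseWeight type t s ^ basePower type * (Q.coeff i * baseWeight type t s ^ i)),
      headKernel]
    refine Finset.sum_congr rfl fun i _ => ?_
    have := basePower_ne_zero type
    rw [attnWeight_eq_baseWeight_pow _ _ _ (by omega), pow_add]
    ring
  intro t ht htT
  refine ⟨?_, fun s hs => ?_⟩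
  · rw [heq, baseWeight_self type ht, hQe]
    simp [hq2]
  have hx0 : 0 ≤ baseWeight type t s := attnWeight_nonneg _ _ _ _
  rw [heq, hQe, abs_mul, abs_pow, abs_pow, abs_of_nonneg hx0]
  set x := baseWeight type t s with hx
  have hxB : x ≤ B := baseWeight_le type ht htT s
  have hgap := baseBound_le_abs_sub_one type ht htT hs
  rw [← hx, ← hB] at hgap
  have hpow := baseWeight_pow_le type ht htT s
  rw [← hx] at hpow
  have hu : |B⁻¹ * (x - 1)| ≤ 1 := by
    rw [abs_mul, abs_inv, abs_of_pos (by linarith : 0 < B), inv_mul_le_iff₀ (by linarith), mul_one,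
      abs_le]
    constructor <;> linarith
  have h3 := hq3 _ hu
  have h4 : |q.eval (B⁻¹ * (x - 1))| ≤ 400 * memScale type T / (2 * N + 1) := by
    rw [le_div_iff₀ (by positivity)]
    rw [abs_mul, abs_inv, abs_of_pos (by linarith : 0 < B)] at h3
    have h5 : 1 ≤ 400 * memScale type T * (B⁻¹ * |x - 1|) := by
      rw [mul_left_comm, ← div_eq_inv_mul, one_le_div (by linarith)]
      exact hgap
    have h6 := abs_nonneg (q.eval (B⁻¹ * (x - 1)))
    set y := |q.eval (B⁻¹ * (x - 1))|
    set v := B⁻¹ * |x - 1|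
    calc y * (2 * N + 1) ≤ y * (2 * N + 1) * (400 * memScale type T * v) :=
          le_mul_of_one_le_right (by positivity) h5
      _ = 400 * memScale type T * ((2 * N + 1) * v * y) := by ring
      _ ≤ 400 * memScale type T * 1 := by gcongr
      _ = _ := mul_one _
  calc _ ≤ (memScale type T * kernelMajorant type s) * (400 * memScale type T / (2 * N + 1)) ^ n := by
        gcongr
        exact (pow_nonneg hx0 _).trans hpow
    _ = _ := by ring

theorem exists_headKernel :
    ∃ C : ℕ → ℝ, ∀ (type : RPEType) (n k H T : ℕ), 1 ≤ n → 1 ≤ H → H ≤ 2 * k + 1 → 1 ≤ T →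
      ∃ α p : Fin k → ℝ, (∀ i, SummableExponent type (p i)) ∧ ∀ t : ℕ, 1 ≤ t → t ≤ T →
        Summable (fun s => |headKernel type α p (memVal type t) s|) ∧
        ∑' s, |headKernel type α p (memVal type t) s| ≤ 1 ∧
        ∑' s, |headKernel type α p (memVal type t) s - if s = t then 1 else 0| ≤
          C n / (H : ℝ) ^ n * memScale type T ^ (n + 1) := by
  set C₀ := (∑' s, kernelMajorant .lin s) + ∑' s, kernelMajorant .log s with hC₀
  have hn0 : ∀ type s, 0 ≤ kernelMajorant type s := fun type s => attnWeight_nonneg _ _ _ _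
  have hts0 : ∀ type, 0 ≤ ∑' s, kernelMajorant type s := fun type => tsum_nonneg (hn0 type)
  have hC₀' : ∀ type, ∑' s, kernelMajorant type s ≤ C₀ := by
    intro type
    cases type
    · linarith [hts0 .log]
    · linarith [hts0 .lin]
  have hC00 : 0 ≤ C₀ := (hts0 .lin).trans (hC₀' .lin)
  -- The summand 1 covers `k = 0`, where the zero kernel has error 1 and `H = 1`. The factor 2 pays
  -- for the normalization, and `2400 n = 400 * 6 n` because `H ≤ 6 n (2N + 1)`.
  refine ⟨fun n => 1 + 2 * (C₀ * (2400 * n) ^ n), fun type n k H T hn hH hHk hT => ?_⟩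
  have hE := memScale_pos type hT
  rcases Nat.eq_zero_or_pos k with rfl | hk
  · have hH1 : H = 1 := by omega
    refine ⟨0, 0, fun i => i.elim0, fun t _ _ => ?_⟩
    have hz : ∀ s, headKernel type (0 : Fin 0 → ℝ) 0 (memVal type t) s = 0 := fun s =>
      Finset.sum_of_isEmpty _
    simp only [hz, abs_zero, tsum_zero]
    refine ⟨summable_zero, zero_le_one, ?_⟩
    have : ∀ s : ℕ, |(0 : ℝ) - if s = t then 1 else 0| = if s = t then 1 else 0 := fun s => by
      split_ifs <;> simp
    simp only [this, tsum_ite_eq, hH1, Nat.cast_one, one_pow, div_one]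
    have h1 : 1 ≤ memScale type T ^ (n + 1) := one_le_pow₀ hE
    have h2 : 0 ≤ 2 * (C₀ * (2400 * (n : ℝ)) ^ n) := by positivity
    nlinarith
  set N := (k - 1) / (2 * n) with hN
  have hNk : 2 * N * n < k := by
    have := Nat.div_mul_le_self (k - 1) (2 * n)
    rw [← hN] at this
    have e : N * (2 * n) = 2 * N * n := by ring
    omega
  have hNH : (H : ℝ) ≤ 6 * n * (2 * N + 1) := by
    have h1 := Nat.lt_div_mul_add (a := k - 1) (b := 2 * n) (by omega)
    rw [← hN] at h1
    have h2 : H ≤ 6 * n * (2 * N + 1) := by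
      have : N * (2 * n) = 2 * (N * n) := by ring
      have : 6 * n * (2 * N + 1) = 12 * (N * n) + 6 * n := by ring
      omega
    exact_mod_cast h2
  obtain ⟨α, p, hp, hker⟩ := exists_polynomial_kernel type hNk hT
  have hH0 : (0 : ℝ) < H := by exact_mod_cast hH
  set X := memScale type T * (400 * memScale type T / (2 * N + 1)) ^ n with hX
  have hX0 : 0 ≤ X := by positivity
  have hXle : X ≤ (2400 * n) ^ n / (H : ℝ) ^ n * memScale type T ^ (n + 1) := by
    have h1 : 400 * memScale type T / (2 * N + 1) ≤ 2400 * n / H * memScale type T := by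
      rw [div_mul_eq_mul_div, div_le_div_iff₀ (by positivity) hH0]
      calc 400 * memScale type T * H ≤ 400 * memScale type T * (6 * n * (2 * N + 1)) := by gcongr
        _ = _ := by ring
    calc X ≤ memScale type T * (2400 * n / H * memScale type T) ^ n := by
          rw [hX]; gcongr
      _ = _ := by rw [mul_pow, div_pow]; ring
  set e := C₀ * X with he
  have he0 : 0 ≤ e := by positivity
  -- The off-peak mass is at most `e` for every delay up to `T`, so one constant factor in the
  -- coefficients makes all the `ℓ¹` norms at most one.
  refine ⟨fun i => (1 + e)⁻¹ * α i, p, hp, fun t ht htT => ?_⟩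
  obtain ⟨hk1, hk2⟩ := hker t ht htT
  set v := headKernel type α p (memVal type t) with hv
  have hw : ∀ s, headKernel type (fun i => (1 + e)⁻¹ * α i) p (memVal type t) s
      = (1 + e)⁻¹ * v s := fun s => by
    simp only [hv, headKernel, Finset.mul_sum, mul_assoc]
  simp only [hw]
  have hd : ∀ s, |v s - if s = t then 1 else 0| ≤ kernelMajorant type s * X := by
    intro s
    split_ifs with hs
    · rw [hs, hk1, sub_self, abs_zero]
      exact mul_nonneg (hn0 _ _) hX0
    · rw [sub_zero]
      exact hk2 s hs
  have hmaj := (summable_kernelMajorant type).mul_right X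
  have hds : Summable fun s => |v s - if s = t then 1 else 0| :=
    Summable.of_nonneg_of_le (fun s => abs_nonneg _) hd hmaj
  have hdt : ∑' s, |v s - if s = t then 1 else 0| ≤ e := by
    refine (hds.tsum_le_tsum hd hmaj).trans ?_
    rw [tsum_mul_right]
    exact mul_le_mul_of_nonneg_right (hC₀' type) hX0
  have hδ : Summable fun s : ℕ => if s = t then (1 : ℝ) else 0 :=
    summable_of_ne_finset_zero (s := {t}) fun s hs => by simp_all
  have hvle : ∀ s, |v s| ≤ |v s - if s = t then 1 else 0| + if s = t then 1 else 0 := by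
    intro s
    have := abs_add_le (v s - if s = t then 1 else 0) (if s = t then 1 else 0)
    rw [sub_add_cancel] at this
    refine this.trans (add_le_add le_rfl (le_of_eq ?_))
    split_ifs <;> simp
  have hvs : Summable fun s => |v s| :=
    Summable.of_nonneg_of_le (fun s => abs_nonneg _) hvle (hds.add hδ)
  have hvt : ∑' s, |v s| ≤ 1 + e := by
    refine (hvs.tsum_le_tsum hvle (hds.add hδ)).trans ?_
    rw [hds.tsum_add hδ, tsum_ite_eq]
    linarith
  have h1e : 0 < 1 + e := by linarith
  have habs : ∀ s, |(1 + e)⁻¹ * v s| = (1 + e)⁻¹ * |v s| := fun s => by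
    rw [abs_mul, abs_of_pos (inv_pos.2 h1e)]
  refine ⟨by simpa only [habs] using hvs.mul_left _, ?_, ?_⟩
  · simp only [habs, tsum_mul_left]
    rw [inv_mul_le_iff₀ h1e]
    linarith
  · have hfin : ∀ s, |(1 + e)⁻¹ * v s - if s = t then 1 else 0| ≤
        |v s - if s = t then 1 else 0| + e * if s = t then 1 else 0 := by
      intro s
      have hi : (1 + e)⁻¹ ≤ 1 := inv_le_one_of_one_le₀ (by linarith)
      have hi0 : 0 ≤ (1 + e)⁻¹ := by positivity
      have e1 : (1 + e)⁻¹ * v s - (if s = t then 1 else 0) =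
          (1 + e)⁻¹ * (v s - if s = t then 1 else 0) - (1 + e)⁻¹ * (e * if s = t then 1 else 0) := by
        field_simp
        ring
      have h5 : 0 ≤ e * if s = t then (1 : ℝ) else 0 := by split_ifs <;> simp [he0]
      rw [e1]
      refine (abs_sub _ _).trans (add_le_add ?_ ?_)
      · rw [abs_mul, abs_of_nonneg hi0]
        exact mul_le_of_le_one_left (abs_nonneg _) hi
      · rw [abs_of_nonneg (mul_nonneg hi0 h5)]
        exact mul_le_of_le_one_left h5 hi
    have hs2 := hds.add (hδ.mul_left e)
    have hs1 : Summable fun s => |(1 + e)⁻¹ * v s - if s = t then 1 else 0| :=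
      Summable.of_nonneg_of_le (fun s => abs_nonneg _) hfin hs2
    refine (hs1.tsum_le_tsum hfin hs2).trans ?_
    rw [hds.tsum_add (hδ.mul_left e), tsum_mul_left, tsum_ite_eq, mul_one]
    calc _ ≤ e + e := by linarith
      _ = 2 * (C₀ * X) := by rw [he]; ring
      _ ≤ 2 * (C₀ * ((2400 * n) ^ n / (H : ℝ) ^ n * memScale type T ^ (n + 1))) := by gcongr
      _ = 2 * (C₀ * (2400 * n) ^ n) / (H : ℝ) ^ n * memScale type T ^ (n + 1) := by ring
      _ ≤ _ := by
        gcongr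
        linarith

end Kernel

/-! ### Two-layer networks from lists of neurons -/

/-- The two-layer network of width `m` whose neurons are the first `m` entries of a list. -/
def TwoLayerNet.ofList {D : ℕ} (m : ℕ) {V : Type} [Zero V] (L : List (V × (Fin D → ℝ) × ℝ)) :
    TwoLayerNet D m V where
  a k := (L[(k : ℕ)]?.getD 0).1
  b k := (L[(k : ℕ)]?.getD 0).2.1
  c k := (L[(k : ℕ)]?.getD 0).2.2

theorem sum_range_getD_eq_sum_map {α V : Type*} [AddCommMonoid V] (φ : α → V) (x₀ : α) (h₀ : φ x₀ = 0)
    (L : List α) {m : ℕ} (h : L.length ≤ m) :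
    ∑ k ∈ Finset.range m, φ (L[k]?.getD x₀) = (L.map φ).sum := by
  induction L generalizing m with
  | nil => simp [h₀]
  | cons q L ih =>
    obtain ⟨m, rfl⟩ : ∃ m', m = m' + 1 := ⟨m - 1, by simp at h; omega⟩
    rw [Finset.sum_range_succ']
    simp only [List.getElem?_cons_succ, List.getElem?_cons_zero, Option.getD_some, List.map_cons,
      List.sum_cons]
    rw [ih (by simpa using h), add_comm]

theorem TwoLayerNet.apply_ofList {D m : ℕ} {V : Type} [AddCommMonoid V] [Module ℝ V]
    (L : List (V × (Fin D → ℝ) × ℝ)) (h : L.length ≤ m) (x : Fin D → ℝ) :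
    (TwoLayerNet.ofList m L).apply x = (L.map fun q => relu (q.2.1 ⬝ᵥ x + q.2.2) • q.1).sum := by
  rw [← sum_range_getD_eq_sum_map (fun q => relu (q.2.1 ⬝ᵥ x + q.2.2) • q.1) 0 (by simp) L h]
  exact Fin.sum_univ_eq_sum_range
    (fun k => relu ((L[k]?.getD 0).2.1 ⬝ᵥ x + (L[k]?.getD 0).2.2) • (L[k]?.getD 0).1) m

/-! ### The retrieval network -/

/-- The coordinates of the residual stream: `M + 1` token slots, `M` stored memory values, a
constant (`true`), and an accumulator (`false`). -/
abbrev Coord (M d : ℕ) : Type := (Fin (M + 1) × Fin d) ⊕ (Fin M ⊕ Bool)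

/-- The embedding dimension. -/
abbrev coordDim (M d : ℕ) : ℕ := Fintype.card (Coord M d)

/-- The numbering of the coordinates. -/
def coordEquiv (M d : ℕ) : Coord M d ≃ Fin (coordDim M d) := Fintype.equivFin _

/-- The parameters of a network that stores the memory values, retrieves two tokens per layer, and
distributes the neurons of the readout function over all layers with complete information. -/
structure RetrievalNet (type : RPEType) (d M k H m : ℕ) where
  memNet : Fin M → List (ℝ × (Fin d → ℝ) × ℝ)
  readNet : ℕ → List (ℝ × (Fin (M + 1) × Fin d → ℝ) × ℝ)
  α : Fin M → Fin k → ℝ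
  p : Fin M → Fin k → ℝ
  scale : ℝ
  shift : ℝ
  head : Fin M → Fin k → Fin H
  summableExponent : ∀ j i, SummableExponent type (p j i)
  scale_pos : 0 < scale
  four_le : 4 ≤ m
  length_memNet : ∀ j, 4 * (memNet j).length ≤ m
  length_readNet : ∀ l, 4 * (readNet l).length ≤ m
  readNet_early : ∀ l, readNet l ≠ [] → M ≤ 2 * l
  head_inj : ∀ j i j' i', head j i = head j' i' → (j : ℕ) % 2 = (j' : ℕ) % 2 ∧ i = i'

/-! ### Linear algebra on the residual stream -/

section Coordinates

variable {M d : ℕ}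

/-- The functional on the residual stream that acts on the token slots. -/
def liftTok (b : Fin (M + 1) × Fin d → ℝ) : Fin (coordDim M d) → ℝ :=
  fun a => Sum.elim b (fun _ => 0) ((coordEquiv M d).symm a)

theorem liftTok_dotProduct (b : Fin (M + 1) × Fin d → ℝ) (x : Coord M d → ℝ) :
    liftTok b ⬝ᵥ (x ∘ (coordEquiv M d).symm) = b ⬝ᵥ fun q => x (Sum.inl q) := by
  have : liftTok b = (Sum.elim b fun _ => 0) ∘ (coordEquiv M d).symm := rfl
  rw [this, comp_equiv_dotProduct_comp_equiv]
  simp [dotProduct, Fintype.sum_sum_type]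

/-- The functional on the residual stream that acts on the current token. -/
def liftCur (b : Fin d → ℝ) : Fin (coordDim M d) → ℝ :=
  liftTok fun q => if q.1 = 0 then b q.2 else 0

theorem liftCur_dotProduct (b : Fin d → ℝ) (x : Coord M d → ℝ) :
    liftCur b ⬝ᵥ (x ∘ (coordEquiv M d).symm) = b ⬝ᵥ fun i => x (Sum.inl (0, i)) := by
  rw [liftCur, liftTok_dotProduct]
  simp [dotProduct, Fintype.sum_prod_type]

/-- The unit vector of a coordinate. -/
def coordVec (a : Coord M d) : Fin (coordDim M d) → ℝ := Pi.single a 1 ∘ (coordEquiv M d).symm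

theorem coordVec_dotProduct (a : Coord M d) (x : Coord M d → ℝ) :
    coordVec a ⬝ᵥ (x ∘ (coordEquiv M d).symm) = x a := by
  rw [coordVec, comp_equiv_dotProduct_comp_equiv]
  simp

/-- The matrix that moves a multiple of the current token to the slot of memory `j`. -/
def moveMatrix (j : Fin M) (r : ℝ) : Matrix (Fin (coordDim M d)) (Fin (coordDim M d)) ℝ :=
  fun a b => Sum.elim (fun q => if q.1 = j.succ then r * coordVec (Sum.inl (0, q.2)) b else 0)
    (fun _ => 0) ((coordEquiv M d).symm a)

theorem moveMatrix_mulVec (j : Fin M) (r : ℝ) (x : Coord M d → ℝ) :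
    moveMatrix j r *ᵥ (x ∘ (coordEquiv M d).symm) =
      (Sum.elim (fun q => if q.1 = j.succ then r * x (Sum.inl (0, q.2)) else 0) fun _ => 0) ∘
        (coordEquiv M d).symm := by
  ext a
  simp only [Matrix.mulVec, moveMatrix, Function.comp]
  rcases (coordEquiv M d).symm a with q | q
  · simp only [Sum.elim_inl]
    split_ifs
    · rw [← coordVec_dotProduct (Sum.inl (0, q.2)) x]
      simp only [dotProduct, Finset.mul_sum, mul_assoc]
    · simp [dotProduct]
  · simp [dotProduct]

/-- The matrix with a single nonzero entry. -/
def entryMatrix (a b : Coord M d) (r : ℝ) : Matrix (Fin (coordDim M d)) (Fin (coordDim M d)) ℝ :=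
  fun a' b' => coordVec a a' * (r * coordVec b b')

theorem entryMatrix_mulVec (a b : Coord M d) (r : ℝ) (x : Coord M d → ℝ) :
    entryMatrix a b r *ᵥ (x ∘ (coordEquiv M d).symm) =
      (fun c => Pi.single (M := fun _ => ℝ) a 1 c * (r * x b)) ∘ (coordEquiv M d).symm := by
  ext a'
  simp only [Matrix.mulVec, entryMatrix, Function.comp]
  rw [← coordVec_dotProduct b x]
  simp only [dotProduct, Finset.mul_sum, mul_assoc]
  rfl

end Coordinates

/-! ### Attention blocks that retrieve two memories per layer -/

namespace RetrievalNet

variable {type : RPEType} {d M k H m : ℕ} (N : RetrievalNet type d M k H m)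

open Classical in
/-- The memory and the coefficient that a head of layer `l` handles. -/
def assign (l : ℕ) (h : Fin H) : Option (Fin M × Fin k) :=
  if hx : ∃ q : Fin M × Fin k, (q.1 : ℕ) / 2 + 1 = l ∧ N.head q.1 q.2 = h then some hx.choose
  else none

/-- Two memories handled in the same layer have different parity, so a shared head forces equal
memory and equal coefficient index. -/
theorem assign_eq_some (l : ℕ) (h : Fin H) (q : Fin M × Fin k) :
    N.assign l h = some q ↔ (q.1 : ℕ) / 2 + 1 = l ∧ N.head q.1 q.2 = h := by
  unfold assign
  split_ifs with hx
  · have h1 := hx.choose_spec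
    rw [Option.some_inj]
    constructor
    · intro h2; rw [← h2]; exact h1
    · intro h2
      have h3 := N.head_inj _ _ _ _ (h1.2.trans h2.2.symm)
      refine Prod.ext (Fin.ext ?_) h3.2
      have := h1.1
      have := h2.1
      omega
  · simp only [false_iff]
    exact fun h2 => hx ⟨q, h2⟩

/-- The attention block of layer `l`. -/
def attnLayer (l : ℕ) : AttnLayer (coordDim M d) H where
  -- The query carries `p μ` in the constant coordinate and the key carries 1 there, so the product
  -- is `p μ` whichever position is attended to.
  WQ h := (N.assign l h).elim 0 fun q =>
    entryMatrix (.inr (.inr true)) (.inr (.inl q.1)) (N.p q.1 q.2)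
  WK _ := entryMatrix (.inr (.inr true)) (.inr (.inr true)) 1
  WV h := (N.assign l h).elim 0 fun q => moveMatrix q.1 (N.α q.1 q.2)
  WO := 1
  -- Idle heads must converge too; exponent 2 is summable for both encodings.
  p h := (N.assign l h).elim 2 fun q => N.p q.1 q.2
  p_pos h := by
    rcases N.assign l h with _ | q
    · exact two_pos
    · exact (N.summableExponent q.1 q.2).pos

theorem summableExponent_attnLayer (l : ℕ) (h : Fin H) :
    SummableExponent type ((N.attnLayer l).p h) := by
  simp only [attnLayer]
  rcases N.assign l h with _ | q
  · cases type
    · exact two_pos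
    · exact one_lt_two
  · exact N.summableExponent q.1 q.2

/-- A sequence of residual streams that is bounded. -/
def Bounded {ι : Type*} (x : ℤ → ι → ℝ) : Prop := ∃ C : ℝ, ∀ t a, |x t a| ≤ C

theorem summable_attnWeight_mul {p : ℝ} (hp : SummableExponent type p) (q : ℝ) {u : ℕ → ℝ} {C : ℝ}
    (hu : ∀ s, |u s| ≤ C) : Summable fun s => attnWeight type p q s * u s := by
  refine Summable.of_norm_bounded ((hp.summable q).mul_right C) fun s => ?_
  rw [Real.norm_eq_abs, abs_mul, abs_of_nonneg (attnWeight_nonneg _ _ _ _)]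
  exact mul_le_mul_of_nonneg_left (hu s) (attnWeight_nonneg _ _ _ _)

theorem attnLayer_dot (l : ℕ) (h : Fin H) (x y : Coord M d → ℝ) (hy : y (.inr (.inr true)) = 1) :
    ((N.attnLayer l).WQ h *ᵥ (x ∘ (coordEquiv M d).symm)) ⬝ᵥ
      ((N.attnLayer l).WK h *ᵥ (y ∘ (coordEquiv M d).symm)) =
      (N.assign l h).elim 0 fun q => N.p q.1 q.2 * x (.inr (.inl q.1)) := by
  simp only [attnLayer]
  rcases N.assign l h with _ | q
  · simp
  · simp only [Option.elim_some]
    rw [entryMatrix_mulVec, entryMatrix_mulVec, comp_equiv_dotProduct_comp_equiv, hy, one_mul]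
    simp only [dotProduct, mul_one]
    rw [Finset.sum_eq_single (.inr (.inr true))]
    · simp
    · intro b _ hb; simp [Pi.single_eq_of_ne hb]
    · simp

theorem attnLayer_term (l : ℕ) (x : ℤ → Coord M d → ℝ) (hx1 : ∀ t, x t (.inr (.inr true)) = 1)
    (t : ℤ) (h : Fin H) (s : ℕ) :
    (N.attnLayer l).term type (fun t => x t ∘ (coordEquiv M d).symm) t h s =
      attnWeight type ((N.attnLayer l).p h)
        ((N.assign l h).elim 0 fun q => N.p q.1 q.2 * x t (.inr (.inl q.1))) s •
        (x (t - s) ∘ (coordEquiv M d).symm) := by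
  rw [AttnLayer.term, attnLayer_dot _ _ _ _ _ (hx1 _)]

theorem summable_attnLayer_term (l : ℕ) (x : ℤ → Coord M d → ℝ)
    (hx1 : ∀ t, x t (.inr (.inr true)) = 1) (hx : Bounded x) (t : ℤ) (h : Fin H) :
    Summable ((N.attnLayer l).term type (fun t => x t ∘ (coordEquiv M d).symm) t h) := by
  obtain ⟨C, hC⟩ := hx
  rw [Pi.summable]
  intro a
  simp only [N.attnLayer_term l x hx1, Pi.smul_apply, smul_eq_mul]
  exact summable_attnWeight_mul (N.summableExponent_attnLayer l h) _ fun s => hC _ _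

/-- The token that is retrieved for memory `j` when the stored value is `μ`. -/
def retrieved (X : ℤ → Fin d → ℝ) (t : ℤ) (j : Fin M) (μ : ℝ) (i : Fin d) : ℝ :=
  ∑' s : ℕ, headKernel type (N.α j) (N.p j) μ s * X (t - s) i

/-- The value matrices read only the current-token slot and put coefficient `α` times it into the
slot of the assigned memory, so the heads of one memory add up to its kernel. -/
theorem attnLayer_apply (l : ℕ) (x : ℤ → Coord M d → ℝ) (hx1 : ∀ t, x t (.inr (.inr true)) = 1)
    (hx : Bounded x) (t : ℤ) :
    (N.attnLayer l).apply type (fun t => x t ∘ (coordEquiv M d).symm) t =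
      (Sum.elim (fun q : Fin (M + 1) × Fin d => Fin.cases (motive := fun _ => ℝ) 0 (fun j : Fin M =>
        if (j : ℕ) / 2 + 1 = l then
          N.retrieved (fun t i => x t (.inl (0, i))) t j (x t (.inr (.inl j))) q.2
        else 0) q.1) fun _ => 0) ∘ (coordEquiv M d).symm := by
  have hterm : ∀ h : Fin H,
      ∑' s, (N.attnLayer l).term type (fun t => x t ∘ (coordEquiv M d).symm) t h s =
      (fun a => ∑' s : ℕ, attnWeight type ((N.attnLayer l).p h)
        ((N.assign l h).elim 0 fun q => N.p q.1 q.2 * x t (.inr (.inl q.1))) s * x (t - s) a) ∘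
        (coordEquiv M d).symm := by
    intro h
    ext a
    rw [tsum_apply (N.summable_attnLayer_term l x hx1 hx t h)]
    simp only [N.attnLayer_term l x hx1, Pi.smul_apply, smul_eq_mul, Function.comp]
  obtain ⟨C, hC⟩ := hx
  unfold AttnLayer.apply
  simp only [hterm]
  rw [show (N.attnLayer l).WO = 1 from rfl, Matrix.one_mulVec]
  ext a
  rw [Finset.sum_apply]
  simp only [Function.comp]
  set S : Fin H → Coord M d → ℝ := fun h a => ∑' s : ℕ, attnWeight type ((N.attnLayer l).p h)
    ((N.assign l h).elim 0 fun q => N.p q.1 q.2 * x t (.inr (.inl q.1))) s * x (t - s) a with hS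
  have hhead : ∀ h, ((N.attnLayer l).WV h *ᵥ fun a => S h ((coordEquiv M d).symm a)) a =
      (N.assign l h).elim 0 fun q => Sum.elim (fun q' => if q'.1 = q.1.succ then
        N.α q.1 q.2 * S h (.inl (0, q'.2)) else 0) (fun _ => 0) ((coordEquiv M d).symm a) := by
    intro h
    simp only [attnLayer]
    rcases N.assign l h with _ | q
    · simp
    · exact congrFun (moveMatrix_mulVec q.1 (N.α q.1 q.2) (S h)) a
  change ∑ h, ((N.attnLayer l).WV h *ᵥ fun a => S h ((coordEquiv M d).symm a)) a = _
  simp only [hhead]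
  rcases (coordEquiv M d).symm a with ⟨j', i⟩ | q
  · simp only [Sum.elim_inl]
    refine Fin.cases ?_ (fun j => ?_) j'
    · rw [Finset.sum_eq_zero]
      · rfl
      · intro h _
        rcases N.assign l h with _ | q
        · rfl
        · simp [(Fin.succ_ne_zero q.1).symm]
    · simp only [Fin.cases_succ]
      split_ifs with hj
      · have hinj : Function.Injective (N.head j) := fun i i' hi => (N.head_inj j i j i' hi).2
        have has : ∀ i, N.assign l (N.head j i) = some (j, i) := fun i =>
          (N.assign_eq_some l _ _).2 ⟨hj, rfl⟩
        rw [← Fintype.sum_of_injective (N.head j) hinj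
          (fun c => ∑' s : ℕ, N.α j c * (attnWeight type (N.p j c) (N.p j c * x t (.inr (.inl j))) s *
            x (t - s) (.inl (0, i))))]
        · rw [retrieved, ← Summable.tsum_finsetSum]
          · refine tsum_congr fun s => ?_
            rw [headKernel, Finset.sum_mul]
            exact Finset.sum_congr rfl fun c _ => by ring
          · intro c _
            exact (summable_attnWeight_mul (N.summableExponent j c) _ fun s => hC _ _).mul_left _
        · intro h hh
          rcases has' : N.assign l h with _ | q
          · rfl
          · have := (N.assign_eq_some l h q).1 has'
            simp only [Option.elim_some]
            rw [if_neg]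
            intro hq
            apply hh
            rw [Fin.succ_inj.1 hq]
            exact ⟨q.2, this.2⟩
        · intro c
          simp only [has, Option.elim_some, if_true, hS, attnLayer]
          rw [tsum_mul_left]
      · rw [Finset.sum_eq_zero]
        intro h _
        rcases has' : N.assign l h with _ | q
        · rfl
        · have := (N.assign_eq_some l h q).1 has'
          simp only [Option.elim_some]
          rw [if_neg]
          intro hq
          rw [← Fin.succ_inj.1 hq] at this
          exact hj this.1
  · rw [Finset.sum_eq_zero]
    · rfl
    · intro h _
      rcases N.assign l h with _ | q <;> rfl

end RetrievalNet

/-- For both types the rounding leaves untouched those coordinates to which a feed-forward network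
contributes nothing. -/
theorem precision_zero (type : RPEType) : precision type 0 = 0 := by
  cases type <;> simp [precision]

/-! ### Feed-forward networks, readout, and the assembled Transformer -/

namespace RetrievalNet

variable {type : RPEType} {d M k H m : ℕ} (N : RetrievalNet type d M k H m)

theorem sum_map_neurons {D : ℕ} {ι : Type*} [Fintype ι] (L : List (ℝ × (ι → ℝ) × ℝ)) (r : ℝ)
    (v : Fin D → ℝ) (lift : (ι → ℝ) → Fin D → ℝ) (x : Fin D → ℝ) (y : ι → ℝ)
    (h : ∀ b, lift b ⬝ᵥ x = b ⬝ᵥ y) :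
    ((L.map fun q => ((r * q.1) • v, lift q.2.1, q.2.2)).map
      fun q : (Fin D → ℝ) × (Fin D → ℝ) × ℝ => relu (q.2.1 ⬝ᵥ x + q.2.2) • q.1).sum =
      (r * listNet L y) • v := by
  induction L with
  | nil => simp [listNet]
  | cons q L ih =>
    simp only [List.map_cons, List.sum_cons, ih, listNet, h, smul_smul, ← add_smul]
    congr 1
    ring

/-- The neurons that compute memory `j`. -/
def memNeurons (j : ℕ) :
    List ((Fin (coordDim M d) → ℝ) × (Fin (coordDim M d) → ℝ) × ℝ) :=
  if h : j < M then (N.memNet ⟨j, h⟩).map fun q =>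
    ((1 * q.1) • coordVec (.inr (.inl ⟨j, h⟩)), liftCur q.2.1, q.2.2)
  else []

/-- The neurons of the feed-forward network of layer `l`. -/
def ffnNeurons (l : ℕ) : List ((Fin (coordDim M d) → ℝ) × (Fin (coordDim M d) → ℝ) × ℝ) :=
  (N.memNeurons (2 * l) ++ N.memNeurons (2 * l + 1)) ++
    (((N.readNet l).map fun q =>
      ((N.scale * q.1) • coordVec (.inr (.inr false)), liftTok q.2.1, q.2.2)) ++
      [(N.shift • coordVec (.inr (.inr false)), 0, 1)])

theorem length_memNeurons_le (j : ℕ) : 4 * (N.memNeurons j).length ≤ m := by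
  unfold memNeurons
  split_ifs
  · simpa using N.length_memNet _
  · simp

/-- The width is split into quarters: two memories, a share of the readout, and the constant neuron
for the shift. -/
theorem length_ffnNeurons_le (l : ℕ) : (N.ffnNeurons l).length ≤ m := by
  have h1 := N.length_memNeurons_le (2 * l)
  have h2 := N.length_memNeurons_le (2 * l + 1)
  have h3 := N.length_readNet l
  have h4 := N.four_le
  simp only [ffnNeurons, List.length_append, List.length_map, List.length_cons, List.length_nil]
  omega

/-- The output of the feed-forward network of layer `l`. -/
def ffnValue (l : ℕ) (x : Coord M d → ℝ) : Coord M d → ℝ :=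
  Sum.elim (fun _ => 0) (Sum.elim
    (fun j => if (j : ℕ) / 2 = l then listNet (N.memNet j) (fun i => x (.inl (0, i))) else 0)
    (fun b => if b then 0 else N.scale * listNet (N.readNet l) (fun q => x (.inl q)) + N.shift))

theorem sum_memNeurons (j : ℕ) (x : Coord M d → ℝ) :
    ((N.memNeurons j).map fun q =>
      relu (q.2.1 ⬝ᵥ (x ∘ (coordEquiv M d).symm) + q.2.2) • q.1).sum =
      (Sum.elim (fun _ => 0) (Sum.elim (fun j' : Fin M => if (j' : ℕ) = j then
        listNet (N.memNet j') (fun i => x (.inl (0, i))) else 0) fun _ => 0)) ∘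
        (coordEquiv M d).symm := by
  unfold memNeurons
  split_ifs with h
  · rw [sum_map_neurons _ _ _ liftCur _ (fun i => x (.inl (0, i))) fun b => liftCur_dotProduct b x]
    ext a
    simp only [one_mul, coordVec, Pi.smul_apply, smul_eq_mul, Function.comp]
    rcases (coordEquiv M d).symm a with q | q | q
    · simp
    · simp only [Sum.elim_inr, Sum.elim_inl]
      split_ifs with hq
      · obtain rfl : q = ⟨j, h⟩ := Fin.ext hq
        simp
      · rw [Pi.single_eq_of_ne, mul_zero]
        intro h'
        apply hq
        simp only [Sum.inr.injEq, Sum.inl.injEq] at h'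
        rw [h']
    · simp
  · ext a
    simp only [List.map_nil, List.sum_nil, Pi.zero_apply, Function.comp]
    rcases (coordEquiv M d).symm a with q | q | q
    · rfl
    · have : (q : ℕ) ≠ j := by have := q.2; omega
      simp [this]
    · rfl

theorem ffn_apply (l : ℕ) (x : Coord M d → ℝ) :
    (TwoLayerNet.ofList m (N.ffnNeurons l)).apply (x ∘ (coordEquiv M d).symm) =
      N.ffnValue l x ∘ (coordEquiv M d).symm := by
  rw [TwoLayerNet.apply_ofList _ (N.length_ffnNeurons_le l), ffnNeurons]
  simp only [List.map_append, List.sum_append]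
  rw [sum_memNeurons, sum_memNeurons, sum_map_neurons _ _ _ liftTok _ (fun q => x (.inl q))
    fun b => liftTok_dotProduct b x]
  simp only [List.map_cons, List.map_nil, List.sum_cons, List.sum_nil, zero_dotProduct, zero_add,
    add_zero]
  ext a
  simp only [Pi.add_apply, Pi.smul_apply, Function.comp, coordVec, ffnValue, smul_eq_mul]
  rcases (coordEquiv M d).symm a with q | q | q
  · simp
  · simp only [Sum.elim_inr, Sum.elim_inl]
    rw [Pi.single_eq_of_ne (by simp)]
    have h : (q : ℕ) / 2 = l ↔ (q : ℕ) = 2 * l ∨ (q : ℕ) = 2 * l + 1 := by omega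
    by_cases h1 : (q : ℕ) = 2 * l
    · have h2 : ¬ (q : ℕ) = 2 * l + 1 := by omega
      simp [h1]
    · simp [h, h1]
  · cases q
    · simp [relu]
    · simp

/-- The readout neurons. -/
def readoutNeurons : List (ℝ × (Fin (coordDim M d) → ℝ) × ℝ) :=
  ((N.readNet M).map fun q => (q.1, liftTok q.2.1, q.2.2)) ++
    [(1, N.scale⁻¹ • coordVec (.inr (.inr false)), -(M * N.shift / N.scale)),
      (-1, -(N.scale⁻¹ • coordVec (.inr (.inr false))), M * N.shift / N.scale)]

theorem relu_sub_relu_neg (x : ℝ) : relu x - relu (-x) = x := by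
  unfold relu
  rcases le_total 0 x with h | h
  · rw [max_eq_left h, max_eq_right (by linarith), sub_zero]
  · rw [max_eq_right h, max_eq_left (by linarith)]; ring

/-- Two opposite ReLUs reproduce the affine function of the accumulator. All `M` earlier layers add
the shift, including those without readout neurons, hence the correction `M * N.shift`. -/
theorem readout_apply (x : Coord M d → ℝ) :
    (TwoLayerNet.ofList m N.readoutNeurons).apply (x ∘ (coordEquiv M d).symm) =
      listNet (N.readNet M) (fun q => x (.inl q)) +
        (x (.inr (.inr false)) - M * N.shift) / N.scale := by
  have hlen : N.readoutNeurons.length ≤ m := by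
    have h3 := N.length_readNet M
    have h4 := N.four_le
    simp only [readoutNeurons, List.length_append, List.length_map, List.length_cons,
      List.length_nil]
    omega
  rw [TwoLayerNet.apply_ofList _ hlen, readoutNeurons, List.map_append, List.sum_append]
  congr 1
  · induction N.readNet M with
    | nil => simp [listNet]
    | cons q L ih =>
      simp only [List.map_cons, List.sum_cons, ih]
      simp only [listNet, List.map_cons, List.sum_cons, liftTok_dotProduct, smul_eq_mul, mul_comm]
  · simp only [List.map_cons, List.map_nil, List.sum_cons, List.sum_nil, add_zero,
      neg_dotProduct, smul_dotProduct, coordVec_dotProduct, smul_eq_mul, mul_one, mul_neg]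
    rw [← sub_eq_add_neg]
    set u := N.scale⁻¹ * x (.inr (.inr false)) + -(M * N.shift / N.scale) with hu
    have : -(N.scale⁻¹ * x (.inr (.inr false))) + M * N.shift / N.scale = -u := by rw [hu]; ring
    rw [this, relu_sub_relu_neg, hu]
    ring

/-- The Transformer. -/
def transformer : Transformer d (coordDim M d) M H m where
  WE := fun a i => liftTok (Pi.single ((0 : Fin (M + 1)), i) 1) a
  bE := coordVec (.inr (.inr true))
  attn l := N.attnLayer l
  ffn l := TwoLayerNet.ofList m (N.ffnNeurons l)
  readout := TwoLayerNet.ofList m N.readoutNeurons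

/-! ### Evolution of the residual stream -/

variable (μ : Fin M → Token d → ℝ)

/-- All tokens that are retrieved at position `t`, including the current one. -/
def retrievedTuple (X : TokenSeq d) (t : ℤ) (q : Fin (M + 1) × Fin d) : ℝ :=
  Fin.cases (motive := fun _ => ℝ) (X t q.2)
    (fun j => N.retrieved (fun t i => X t i) t j (μ j (X t)) q.2) q.1

/-- The residual stream after `l` feed-forward networks and `l'` attention blocks. -/
def stream (X : TokenSeq d) (l' l : ℕ) (t : ℤ) : Coord M d → ℝ :=
  Sum.elim (fun q => Fin.cases (motive := fun _ => ℝ) (X t q.2) (fun j =>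
      if (j : ℕ) / 2 + 1 < l' then N.retrieved (fun t i => X t i) t j (μ j (X t)) q.2 else 0) q.1)
    (Sum.elim (fun j => if (j : ℕ) / 2 < l then μ j (X t) else 0)
      fun b => if b then 1 else ∑ i ∈ Finset.range l,
        precision type (N.scale * listNet (N.readNet i) (N.retrievedTuple μ X t) + N.shift))

/-- Boundedness and correctness of all intermediate values on an input sequence. -/
structure Valid (X : TokenSeq d) : Prop where
  bounded_token : ∃ C : ℝ, ∀ t i, |X t i| ≤ C
  bounded_mem : ∀ j, ∃ C : ℝ, ∀ t, |μ j (X t)| ≤ C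
  bounded_retrieved : ∀ j i, ∃ C : ℝ, ∀ t,
    |N.retrieved (fun t i => X t i) t j (μ j (X t)) i| ≤ C
  bounded_acc : ∀ l, ∃ C : ℝ, ∀ t, |precision type
    (N.scale * listNet (N.readNet l) (N.retrievedTuple μ X t) + N.shift)| ≤ C
  precision_mem : ∀ j t, precision type (listNet (N.memNet j) (X t).ofLp) = μ j (X t)
  pos_mem : type = .log → ∀ j t, 0 < round (Real.exp (listNet (N.memNet j) (X t).ofLp))
  pos_acc : type = .log → ∀ l t, 0 < round (Real.exp
    (N.scale * listNet (N.readNet l) (N.retrievedTuple μ X t) + N.shift))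

variable {N μ} {X : TokenSeq d}

theorem Valid.bounded_stream (hX : N.Valid μ X) (l' l : ℕ) : Bounded (N.stream μ X l' l) := by
  have key : ∀ a, ∃ C : ℝ, ∀ t, |N.stream μ X l' l t a| ≤ C := by
    rintro (⟨j, i⟩ | j | b)
    · refine Fin.cases ?_ (fun j => ?_) j
      · obtain ⟨C, hC⟩ := hX.bounded_token
        exact ⟨C, fun t => hC t i⟩
      · simp only [stream, Sum.elim_inl, Fin.cases_succ]
        split_ifs
        · exact hX.bounded_retrieved j i
        · exact ⟨0, by simp⟩
    · simp only [stream, Sum.elim_inl, Sum.elim_inr]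
      split_ifs
      · exact hX.bounded_mem j
      · exact ⟨0, by simp⟩
    · cases b
      · choose C hC using hX.bounded_acc
        refine ⟨∑ i ∈ Finset.range l, C i, fun t => ?_⟩
        simp only [stream, Sum.elim_inr]
        exact (Finset.abs_sum_le_sum_abs _ _).trans (Finset.sum_le_sum fun i _ => hC i t)
      · exact ⟨1, by simp [stream]⟩
  choose C hC using key
  refine ⟨∑ a, |C a|, fun t a => (hC a t).trans ((le_abs_self _).trans ?_)⟩
  exact Finset.single_le_sum (f := fun a => |C a|) (fun a _ => abs_nonneg _) (Finset.mem_univ a)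

/-- The slot of memory `j` is zero until block `j / 2 + 1` and is written only there, so the
residual addition acts as an assignment. The current token is never changed, and the delay was
stored one layer earlier. -/
theorem Valid.stream_add_attn (hX : N.Valid μ X) (l : ℕ) (t : ℤ) :
    N.stream μ X l l t ∘ (coordEquiv M d).symm +
      (N.attnLayer l).apply type (fun t => N.stream μ X l l t ∘ (coordEquiv M d).symm) t =
      N.stream μ X (l + 1) l t ∘ (coordEquiv M d).symm := by
  rw [N.attnLayer_apply l _ (fun t => rfl) (hX.bounded_stream l l)]
  ext a
  simp only [Pi.add_apply, Function.comp]
  rcases (coordEquiv M d).symm a with ⟨j, i⟩ | q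
  · refine Fin.cases ?_ (fun j => ?_) j
    · simp [stream]
    · simp only [stream, Sum.elim_inl, Fin.cases_succ, Sum.elim_inr, Fin.cases_zero]
      by_cases h : (j : ℕ) / 2 + 1 = l
      · have h2 : (j : ℕ) / 2 < l := by omega
        simp [h, h2]
      · by_cases h2 : (j : ℕ) / 2 + 1 < l
        · have h3 : (j : ℕ) / 2 + 1 < l + 1 := by omega
          simp only [h, h2, h3, if_true, if_false, add_zero]
        · have h3 : ¬ (j : ℕ) / 2 + 1 < l + 1 := by omega
          simp only [h, h2, h3, if_false, add_zero]
  · simp [stream]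

/-- A nonempty share of the readout occurs only where all tokens have been retrieved; an empty share
ignores its input. -/
theorem listNet_readNet_stream (l l₁ : ℕ) (t : ℤ) :
    listNet (N.readNet l) (fun q => N.stream μ X (l + 1) l₁ t (.inl q)) =
      listNet (N.readNet l) (N.retrievedTuple μ X t) := by
  by_cases h : N.readNet l = []
  · simp [h, listNet]
  · have hM := N.readNet_early l h
    congr 1
    ext ⟨j, i⟩
    refine Fin.cases ?_ (fun j => ?_) j
    · rfl
    · have : (j : ℕ) / 2 < l := by have := j.2; omega
      simp [stream, retrievedTuple, this]

theorem Valid.ffnValue_stream (_hX : N.Valid μ X) (l : ℕ) (t : ℤ) :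
    N.ffnValue l (N.stream μ X (l + 1) l t) =
      Sum.elim (fun _ => 0) (Sum.elim
        (fun j : Fin M => if (j : ℕ) / 2 = l then listNet (N.memNet j) (X t).ofLp else 0)
        (fun b : Bool => if b then 0 else
          N.scale * listNet (N.readNet l) (N.retrievedTuple μ X t) + N.shift)) := by
  unfold ffnValue
  rw [listNet_readNet_stream]
  rfl

theorem Valid.stream_add_ffn (hX : N.Valid μ X) (l : ℕ) (t : ℤ) :
    (N.stream μ X (l + 1) l t ∘ (coordEquiv M d).symm + fun a => precision type
      ((TwoLayerNet.ofList m (N.ffnNeurons l)).apply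
        (N.stream μ X (l + 1) l t ∘ (coordEquiv M d).symm) a)) =
      N.stream μ X (l + 1) (l + 1) t ∘ (coordEquiv M d).symm := by
  rw [ffn_apply, hX.ffnValue_stream]
  ext a
  simp only [Pi.add_apply, Function.comp]
  rcases (coordEquiv M d).symm a with q | j | b
  · simp [stream, precision_zero]
  · simp only [stream, Sum.elim_inr, Sum.elim_inl]
    by_cases h : (j : ℕ) / 2 = l
    · simp [h, hX.precision_mem]
    · by_cases h2 : (j : ℕ) / 2 < l
      · have h3 : (j : ℕ) / 2 < l + 1 := by omega
        simp [h, h2, h3, precision_zero]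
      · have h3 : ¬ (j : ℕ) / 2 < l + 1 := by omega
        simp only [h, h2, h3, if_false, add_zero, precision_zero]
  · cases b
    · simp [stream, Finset.sum_range_succ]
    · simp [stream, precision_zero]

theorem Valid.afterAttn_eq (hX : N.Valid μ X) (l : Fin (M + 1)) (t : ℤ) :
    N.transformer.afterAttn type l
      (fun t => N.stream μ X l l t ∘ (coordEquiv M d).symm) t =
      N.stream μ X (l + 1) l t ∘ (coordEquiv M d).symm :=
  hX.stream_add_attn l t

theorem Valid.layerInput_eq (hX : N.Valid μ X) (l : Fin (M + 1)) :
    N.transformer.layerInput type X l =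
      fun t => N.stream μ X l l t ∘ (coordEquiv M d).symm := by
  induction l using Fin.induction with
  | zero =>
    ext t a
    change (N.transformer.WE *ᵥ (X t).ofLp + N.transformer.bE) a = _
    simp only [transformer, Pi.add_apply, Matrix.mulVec, Function.comp, coordVec, liftTok,
      dotProduct]
    rcases (coordEquiv M d).symm a with ⟨j, i⟩ | j | b
    · refine Fin.cases ?_ (fun j => ?_) j
      · simp [stream, Pi.single_apply]
      · simp [stream]
    · simp [stream]
    · cases b <;> simp [stream]
  | succ l ih =>
    have hs : N.transformer.layerInput type X l.succ = fun t =>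
        N.transformer.afterAttn type l.castSucc (N.transformer.layerInput type X l.castSucc) t +
        fun i => precision type ((N.transformer.ffn l).apply (N.transformer.afterAttn type l.castSucc
          (N.transformer.layerInput type X l.castSucc) t) i) := rfl
    rw [hs, ih]
    ext t a
    rw [hX.afterAttn_eq l.castSucc t]
    exact congrFun (hX.stream_add_ffn l t) a

theorem Valid.output_eq (hX : N.Valid μ X) (t : ℤ) :
    N.transformer.output type t X = listNet (N.readNet M) (N.retrievedTuple μ X t) +
      ∑ l ∈ Finset.range M, (precision type
        (N.scale * listNet (N.readNet l) (N.retrievedTuple μ X t) + N.shift) - N.shift) /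
          N.scale := by
  unfold Transformer.output
  rw [hX.layerInput_eq, hX.afterAttn_eq]
  refine (N.readout_apply _).trans ?_
  rw [Fin.val_last, listNet_readNet_stream]
  congr 1
  rw [← Finset.sum_div, Finset.sum_sub_distrib]
  simp [stream]

theorem wellDefined {𝒳 : Set (TokenSeq d)} (h : ∀ X ∈ 𝒳, N.Valid μ X) :
    N.transformer.WellDefined type 𝒳 := by
  constructor
  · intro X hX l t i
    rw [(h X hX).layerInput_eq]
    exact N.summable_attnLayer_term l _ (fun t => rfl) ((h X hX).bounded_stream l l) t i
  · intro htype X hX l t a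
    rw [(h X hX).layerInput_eq, (h X hX).afterAttn_eq]
    have := congrFun (N.ffn_apply l (N.stream μ X (l + 1) l t)) a
    rw [(h X hX).ffnValue_stream] at this
    change 0 < round (Real.exp ((TwoLayerNet.ofList m (N.ffnNeurons l)).apply _ a))
    rw [Fin.val_castSucc, this]
    simp only [Function.comp]
    rcases (coordEquiv M d).symm a with q | j | b
    · simp
    · simp only [Sum.elim_inr, Sum.elim_inl]
      split_ifs
      · exact (h X hX).pos_mem htype j t
      · simp
    · cases b
      · exact (h X hX).pos_acc htype l t
      · simp

end RetrievalNet

/-! ### Rounding -/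

theorem round_eq_of_abs_sub_lt {y : ℝ} {g : ℤ} (h : |y - g| < 1 / 2) : round y = g := by
  have h1 := abs_sub_round y
  have h2 : |((round y - g : ℤ) : ℝ)| < 1 := by
    push_cast
    calc |(round y : ℝ) - g| ≤ |(round y : ℝ) - y| + |y - g| := abs_sub_le _ _ _
      _ < 1 := by rw [abs_sub_comm]; linarith
  have h3 : |round y - g| < 1 := by exact_mod_cast h2
  have := Int.abs_lt_one_iff.1 h3
  omega

/-- The accuracy at which stored memory values up to `T` are recovered by the precision. -/
def memTolerance (type : RPEType) (T : ℕ) : ℝ :=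
  match type with
  | .lin => 1 / 2
  | .log => 1 / (4 * T)

/-- For `log`, an error `u` in the logarithm changes the integer `g ≤ T` by at most `2 g |u| < 1/2`,
so exponentiation and rounding recover `g`. -/
theorem precision_eq_memVal (type : RPEType) {g T : ℕ} (hg : 1 ≤ g) (hT : g ≤ T) {y : ℝ}
    (hy : |y - memVal type g| < memTolerance type T) :
    precision type y = memVal type g ∧ (type = .log → 0 < round (Real.exp y)) := by
  cases type
  · simp only [memVal, memTolerance, precision] at hy ⊢
    refine ⟨?_, by simp⟩
    rw [round_eq_of_abs_sub_lt (g := (g : ℤ)) (by exact_mod_cast hy)]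
    simp
  · simp only [memVal, memTolerance, precision] at hy ⊢
    have hg' : (1 : ℝ) ≤ g := by exact_mod_cast hg
    have hT' : (g : ℝ) ≤ T := by exact_mod_cast hT
    set u := y - Real.log g with hu
    have hy' : Real.exp y = g * Real.exp u := by
      rw [hu, Real.exp_sub, Real.exp_log (by linarith)]
      field_simp
    have h1 : |u| * (4 * T) < 1 := (lt_div_iff₀ (by linarith)).1 hy
    have hu1 : |u| ≤ 1 := by nlinarith [abs_nonneg u]
    have h2 := Real.abs_exp_sub_one_le hu1
    have h3 : |Real.exp y - (g : ℤ)| < 1 / 2 := by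
      rw [hy', Int.cast_natCast, ← mul_sub_one, abs_mul, abs_of_pos (by linarith : (0 : ℝ) < g)]
      nlinarith [abs_nonneg u, abs_nonneg (Real.exp u - 1)]
    rw [round_eq_of_abs_sub_lt h3]
    refine ⟨by simp, fun _ => by omega⟩

/-- For `lin`, a large scale makes the rounding error of `1/2` relatively small. For `log`, a large
shift makes the exponential large, so rounding it is a small relative error and stays away from
zero. -/
theorem exists_scale_precision (type : RPEType) (R : ℝ) {ε : ℝ} (hε : 0 < ε) :
    ∃ κ B : ℝ, 0 < κ ∧ ∀ y, |y| ≤ R → |precision type (κ * y + B) - (κ * y + B)| ≤ κ * ε ∧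
      (type = .log → 0 < round (Real.exp (κ * y + B))) := by
  cases type
  · refine ⟨1 / (2 * ε), 0, by positivity, fun y _ => ⟨?_, by simp⟩⟩
    rw [abs_sub_comm]
    refine (abs_sub_round _).trans (le_of_eq ?_)
    field_simp
  · refine ⟨1, R + 1 / ε, one_pos, fun y hy => ?_⟩
    rw [one_mul, one_mul]
    set z := y + (R + 1 / ε) with hz
    have hz1 : 1 / ε ≤ z := by have := (abs_le.1 hy).1; linarith
    have hε' : 0 < 1 / ε := by positivity
    have h1 : 1 + 1 / ε ≤ Real.exp z := by have := Real.add_one_le_exp z; linarith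
    have h2 := abs_le.1 (abs_sub_round (Real.exp z))
    set r := (round (Real.exp z) : ℝ) with hr
    have hr0 : 0 < r := by linarith
    have hrε : 1 / ε ≤ 2 * r ∧ 1 / ε ≤ 2 * Real.exp z := by constructor <;> linarith
    have he : 0 < Real.exp z := Real.exp_pos z
    refine ⟨?_, fun _ => Int.cast_pos.1 hr0⟩
    have hlog : precision .log z - z = Real.log (r / Real.exp z) := by
      rw [Real.log_div hr0.ne' he.ne', Real.log_exp]
      rfl
    have h3 : 1 ≤ 2 * r * ε := (div_le_iff₀ hε).1 hrε.1
    have h4 : 1 ≤ 2 * Real.exp z * ε := (div_le_iff₀ hε).1 hrε.2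
    rw [hlog, abs_le]
    constructor
    · have h5 := Real.one_sub_inv_le_log_of_pos (x := r / Real.exp z) (by positivity)
      refine le_trans ?_ h5
      rw [inv_div, one_sub_div hr0.ne', le_div_iff₀ hr0]
      nlinarith
    · refine (Real.log_le_sub_one_of_pos (by positivity)).trans ?_
      rw [div_sub_one he.ne', div_le_iff₀ he]
      nlinarith

/-! ### Lists of neurons -/

section Lists

variable {ι : Type*} [Fintype ι]

theorem abs_listNet_le (L : List (ℝ × (ι → ℝ) × ℝ)) {x : ι → ℝ} (hx : ∀ i, |x i| ≤ 1) :
    |listNet L x| ≤ (L.map barronWeight).sum := by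
  induction L with
  | nil => simp [listNet]
  | cons q L ih =>
    simp only [listNet, List.map_cons, List.sum_cons] at ih ⊢
    exact (abs_add_le _ _).trans (add_le_add (abs_neuron_le_barronWeight q hx) ih)

theorem sum_barronWeight_le_of_sublist {L L' : List (ℝ × (ι → ℝ) × ℝ)} (h : L'.Sublist L) :
    (L'.map barronWeight).sum ≤ (L.map barronWeight).sum := by
  apply (h.map barronWeight).sum_le_sum
  intro a ha
  obtain ⟨q, -, rfl⟩ := List.mem_map.1 ha
  exact barronWeight_nonneg q

theorem listNet_append (L L' : List (ℝ × (ι → ℝ) × ℝ)) (x : ι → ℝ) :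
    listNet (L ++ L') x = listNet L x + listNet L' x := by
  simp [listNet]

theorem sum_listNet_chunks (L : List (ℝ × (ι → ℝ) × ℝ)) (K n : ℕ) (x : ι → ℝ) :
    ∑ r ∈ Finset.range n, listNet ((L.drop (r * K)).take K) x + listNet (L.drop (n * K)) x =
      listNet L x := by
  induction n with
  | zero => simp
  | succ n ih =>
    rw [Finset.sum_range_succ, add_assoc, ← listNet_append, Nat.succ_mul, ← List.drop_drop,
      List.take_append_drop, ih]

theorem exists_layer_split (L : List (ℝ × (ι → ℝ) × ℝ)) {M K : ℕ}
    (hL : L.length ≤ (M / 2 + 1) * K) :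
    ∃ R : ℕ → List (ℝ × (ι → ℝ) × ℝ), (∀ l, (R l).length ≤ K) ∧ (∀ l, (R l).Sublist L) ∧
      (∀ l, R l ≠ [] → M ≤ 2 * l) ∧
      ∀ x, ∑ l ∈ Finset.range (M + 1), listNet (R l) x = listNet L x := by
  -- Layer `c = ⌈M/2⌉` is the first one with all tokens; `M / 2 + 1` layers remain, counting the
  -- last.
  obtain ⟨c, hc, hM⟩ : ∃ c, M + 1 = c + (M / 2 + 1) ∧ M ≤ 2 * c := ⟨(M + 1) / 2, by omega, by omega⟩
  refine ⟨fun l => if c ≤ l then (L.drop ((l - c) * K)).take K else [],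
    fun l => ?_, fun l => ?_, fun l => ?_, fun x => ?_⟩
  · dsimp only
    split_ifs
    · exact List.length_take_le _ _
    · simp
  · dsimp only
    split_ifs
    · exact (List.take_sublist _ _).trans (List.drop_sublist _ _)
    · exact List.nil_sublist _
  · dsimp only
    split_ifs
    · intro _; omega
    · simp
  · have h := sum_listNet_chunks L K (M / 2 + 1) x
    rw [List.drop_eq_nil_of_le hL] at h
    rw [hc, Finset.sum_range_add, Finset.sum_eq_zero, zero_add, ← h]
    · simp only [Nat.le_add_right, if_true, Nat.add_sub_cancel_left]
      exact (add_zero _).symm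
    · intro l hl
      dsimp only
      rw [if_neg (by simpa using hl)]
      rfl

end Lists

/-! ### Tokens -/

theorem norm_concatTokens_sub_sq {k d : ℕ} (x y : Fin k → Token d) :
    ‖concatTokens x - concatTokens y‖ ^ 2 = ∑ j, ‖x j - y j‖ ^ 2 := by
  simp only [EuclideanSpace.norm_sq_eq, concatTokens, Fintype.sum_prod_type]
  rfl

theorem norm_concatTokens_sq {k d : ℕ} (x : Fin k → Token d) :
    ‖concatTokens x‖ ^ 2 = ∑ j, ‖x j‖ ^ 2 := by
  simp only [EuclideanSpace.norm_sq_eq, concatTokens, Fintype.sum_prod_type]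

theorem abs_apply_le_norm {ι : Type*} [Fintype ι] (x : EuclideanSpace ℝ ι) (i : ι) : |x i| ≤ ‖x‖ :=
  PiLp.norm_apply_le x i

theorem norm_sq_le_of_mem_readoutDomain {k d : ℕ} {z : EuclideanSpace ℝ (Fin k × Fin d)}
    (hz : z ∈ readoutDomain k d) : ‖z‖ ^ 2 ≤ k := by
  obtain ⟨x, hx, rfl⟩ := hz
  rw [norm_concatTokens_sq]
  calc ∑ j, ‖x j‖ ^ 2 ≤ ∑ _j : Fin k, (1 : ℝ) :=
        Finset.sum_le_sum fun j _ => pow_le_one₀ (norm_nonneg _) (hx j)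
    _ = k := by simp

theorem abs_apply_le_of_mem_readoutDomain {k d : ℕ} {z : EuclideanSpace ℝ (Fin k × Fin d)}
    (hz : z ∈ readoutDomain k d) (i : Fin k × Fin d) : |z i| ≤ 1 := by
  obtain ⟨x, hx, rfl⟩ := hz
  exact (abs_apply_le_norm (x i.1) i.2).trans (hx i.1)

theorem abs_sub_le_lipNorm_mul {ι : Type*} [Fintype ι] {U : Set (EuclideanSpace ℝ ι)}
    {f : EuclideanSpace ℝ ι → ℝ} (hf : ∃ K : ℝ≥0, LipschitzOnWith K f U)
    {x y : EuclideanSpace ℝ ι} (hx : x ∈ U) (hy : y ∈ U) :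
    |f x - f y| ≤ lipNorm U f * ‖x - y‖ := by
  rcases (norm_nonneg (x - y)).eq_or_lt with h | h
  · rw [sub_eq_zero.1 (norm_eq_zero.1 h.symm)]
    simp
  · rw [← div_le_iff₀ h, lipNorm, ← Real.coe_toNNReal _ (by positivity : 0 ≤ |f x - f y| / ‖x - y‖),
      NNReal.coe_le_coe]
    refine le_csInf hf fun K hK => ?_
    rw [Real.toNNReal_le_iff_le_coe, div_le_iff₀ h, ← Real.dist_eq, ← dist_eq_norm]
    exact hK.dist_le_mul x hx y hy

/-! ### Averaging tokens against a kernel -/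

section Retrieve

variable {d : ℕ}

theorem retrieved_token (X : TokenSeq d) (hX : ∀ t, ‖X t‖ ≤ 1) (t : ℤ) (w : ℕ → ℝ)
    (hw : Summable fun s => |w s|) (hw1 : ∑' s, |w s| ≤ 1) (g : ℕ) :
    ∃ z : Token d, (∀ i, z i = ∑' s : ℕ, w s * X (t - s) i) ∧ ‖z‖ ≤ 1 ∧
      ‖z - X (t - g)‖ ≤ ∑' s, |w s - if s = g then 1 else 0| := by
  have hle : ∀ s : ℕ, ∀ c : ℝ, ‖c • X (t - s)‖ ≤ |c| := fun s c => by
    rw [norm_smul, Real.norm_eq_abs]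
    exact mul_le_of_le_one_right (abs_nonneg _) (hX _)
  have hs : Summable fun s : ℕ => w s • X (t - s) :=
    Summable.of_norm_bounded hw fun s => hle s (w s)
  have hδ : HasSum (fun s : ℕ => (if s = g then (1 : ℝ) else 0) • X (t - s)) (X (t - g)) := by
    have := hasSum_ite_eq g (X (t - (g : ℕ)))
    refine this.congr_fun ?_
    intro s
    split_ifs with h <;> simp [h]
  have hδ' : Summable fun s : ℕ => if s = g then (1 : ℝ) else 0 :=
    (hasSum_ite_eq g (1 : ℝ)).summable
  have hwd : Summable fun s => |w s - if s = g then 1 else 0| := by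
    have h1 : Summable w := hw.of_abs
    exact (h1.sub hδ').abs
  refine ⟨∑' s : ℕ, w s • X (t - s), fun i => ?_, ?_, ?_⟩
  · have := (EuclideanSpace.proj (𝕜 := ℝ) i).map_tsum hs
    simpa using this
  · exact (tsum_of_norm_bounded hw.hasSum fun s => hle s (w s)).trans hw1
  · rw [← hδ.tsum_eq, ← hs.tsum_sub hδ.summable]
    refine tsum_of_norm_bounded hwd.hasSum fun s => ?_
    rw [← sub_smul]
    exact hle s _

end Retrieve

/-! ### Assembly -/

/-- Embedding dimension 0 suffices; this network handles the degenerate cases. -/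
theorem zero_mem_transformerClass {d : ℕ} (type : RPEType) (𝒳 : Set (TokenSeq d)) (M H m : ℕ) :
    (fun _ _ => 0) ∈ transformerClass type 𝒳 (M + 1) H m := by
  refine ⟨0, M, ⟨0, 0, fun _ => ⟨0, 0, 0, 0, fun _ => 1, fun _ => one_pos⟩, fun _ => ⟨0, 0, 0⟩,
    ⟨0, 0, 0⟩⟩, rfl, ⟨fun X _ l t h => ?_, fun _ X _ l t i => i.elim0⟩, ?_⟩
  · rw [Pi.summable]
    exact fun i => i.elim0
  · ext t X
    simp [Transformer.output, TwoLayerNet.apply]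

theorem seqNorm_le_ofReal {d : ℕ} {𝒳 : Set (TokenSeq d)} {F : ℤ → TokenSeq d → ℝ} {b : ℝ}
    (h : ∀ X ∈ 𝒳, ∀ t, |F t X| ≤ b) : seqNorm 𝒳 F ≤ ENNReal.ofReal b := by
  refine iSup_le fun t => iSup₂_le fun X hX => ?_
  rw [Real.enorm_eq_ofReal_abs]
  exact ENNReal.ofReal_le_ofReal (h X hX t)

theorem memScale_pow_sq (type : RPEType) (T n : ℕ) :
    (memScale type T ^ (n + 1)) ^ 2 = match type with
      | .lin => Real.exp (0.02 * (n + 1) * T)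
      | .log => (T : ℝ) ^ (2.02 * ((n : ℝ) + 1)) := by
  cases type
  · simp only [memScale]
    rw [← pow_mul, ← Real.exp_nat_mul]
    congr 1
    push_cast
    ring
  · simp only [memScale]
    rw [← pow_mul, ← Real.rpow_natCast, ← Real.rpow_mul (Nat.cast_nonneg T)]
    congr 1
    push_cast
    ring

theorem memoryLength_eq {M : ℕ} (type : RPEType) (n : ℕ) (T : Fin M → ℕ) :
    memoryLength type n T = Real.sqrt (∑ l, (memScale type (T l) ^ (n + 1)) ^ 2) := by
  simp only [memScale_pow_sq]
  cases type <;> rfl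

theorem memoryLength_nonneg {M : ℕ} (type : RPEType) (n : ℕ) (T : Fin M → ℕ) :
    0 ≤ memoryLength type n T := by
  rw [memoryLength_eq]; exact Real.sqrt_nonneg _

/-- The complexity is calibrated to the rounding tolerance: the factor `T²` for `log` is, up to a
constant, the inverse square of the tolerance. -/
theorem barronNorm_memVal_le {d M : ℕ} {p : ℝ≥0∞} {𝒳 : Set (TokenSeq d)} (type : RPEType)
    (𝓗 : AdaptiveTarget d M p 𝒳) (hfin : memoryComplexity type 𝓗 ≠ ∞) (j : Fin M)
    (hT : 1 ≤ 𝓗.T j) :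
    barronNorm p (tokenSet 𝒳) (fun x => memVal type (𝓗.g j x)) ≠ ∞ ∧
    (barronNorm p (tokenSet 𝒳) (fun x => memVal type (𝓗.g j x))).toReal ^ 2 ≤
      16 * memTolerance type (𝓗.T j) ^ 2 * (memoryComplexity type 𝓗).toReal := by
  cases type
  · have h1 : barronNorm p (tokenSet 𝒳) (fun x => (𝓗.g j x : ℝ)) ^ 2 ≤
        memoryComplexity .lin 𝓗 :=
      le_iSup (fun i => barronNorm p (tokenSet 𝒳) (fun x => (𝓗.g i x : ℝ)) ^ 2) j
    have h2 := ENNReal.toReal_mono hfin h1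
    rw [ENNReal.toReal_pow] at h2
    refine ⟨(𝓗.g_barron j).2, h2.trans ?_⟩
    have := ENNReal.toReal_nonneg (a := memoryComplexity .lin 𝓗)
    simp only [memTolerance]
    nlinarith
  · have h1 : barronNorm p (tokenSet 𝒳) (fun x => Real.log (𝓗.g j x)) ^ 2 * (𝓗.T j : ℝ≥0∞) ^ 2 ≤
        memoryComplexity .log 𝓗 :=
      le_iSup (fun i => barronNorm p (tokenSet 𝒳) (fun x => Real.log (𝓗.g i x)) ^ 2 *
        (𝓗.T i : ℝ≥0∞) ^ 2) j
    have h2 := ENNReal.toReal_mono hfin h1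
    rw [ENNReal.toReal_mul, ENNReal.toReal_pow, ENNReal.toReal_pow, ENNReal.toReal_natCast] at h2
    have hT' : (1 : ℝ) ≤ 𝓗.T j := by exact_mod_cast hT
    refine ⟨fun h => ?_, ?_⟩
    · change barronNorm p (tokenSet 𝒳) (fun x => Real.log (𝓗.g j x)) = ∞ at h
      rw [h] at h1
      apply hfin
      rw [← top_le_iff]
      refine le_trans (le_of_eq ?_) h1
      rw [ENNReal.top_pow two_ne_zero, ENNReal.top_mul]
      exact pow_ne_zero 2 (by exact_mod_cast (by omega : 𝓗.T j ≠ 0))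
    · simp only [memTolerance, memVal]
      set A := (memoryComplexity .log 𝓗).toReal
      have : 16 * (1 / (4 * (𝓗.T j : ℝ))) ^ 2 * A = A / (𝓗.T j : ℝ) ^ 2 := by
        field_simp
        norm_num
      rw [this, le_div_iff₀ (by positivity)]
      exact h2

/-- The squared sampling error is at most `49 * 2 / K` times the squared norm, and the norm is
bounded by the tolerance; `1568 = 98 * 16` makes the error smaller than the tolerance. -/
theorem exists_memNet {d M : ℕ} {p : ℝ≥0∞} (hp : 1 ≤ p) {𝒳 : Set (TokenSeq d)}
    (h𝒳 : ∀ X ∈ 𝒳, ∀ t, ‖X t‖ ≤ 1) (type : RPEType)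
    (𝓗 : AdaptiveTarget d M p 𝒳) (hfin : memoryComplexity type 𝓗 ≠ ∞) (j : Fin M)
    (hT : 1 ≤ 𝓗.T j) {K : ℕ} (hK1 : 1 ≤ K)
    (hK : 1568 * (memoryComplexity type 𝓗).toReal < K) :
    ∃ L : List (ℝ × (Fin d → ℝ) × ℝ), L.length ≤ K ∧ ∀ x ∈ tokenSet 𝒳,
      precision type (listNet L x.ofLp) = memVal type (𝓗.g j x) ∧
      (type = .log → 0 < round (Real.exp (listNet L x.ofLp))) := by
  obtain ⟨h1, h2⟩ := barronNorm_memVal_le type 𝓗 hfin j hT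
  have hx1 : ∀ x ∈ tokenSet 𝒳, ‖x‖ ≤ 1 := by
    rintro x ⟨X, hX, t, rfl⟩; exact h𝒳 X hX t
  obtain ⟨L, hL, hL'⟩ := exists_listNet_approx hp h1 (r := 1)
    (fun x hx => pow_le_one₀ (norm_nonneg x) (hx1 x hx))
    (fun x hx i => (abs_apply_le_norm x i).trans (hx1 x hx)) zero_le_one hK1
  refine ⟨L, hL, fun x hx => precision_eq_memVal type (𝓗.one_le_g j x hx) (𝓗.g_le j x hx) ?_⟩
  rw [abs_sub_comm]
  refine (hL' x hx).trans_lt ?_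
  set B := (barronNorm p (tokenSet 𝒳) (fun x => memVal type (𝓗.g j x))).toReal
  set A := (memoryComplexity type 𝓗).toReal
  have hB : 0 ≤ B := ENNReal.toReal_nonneg
  have hτ : 0 < memTolerance type (𝓗.T j) := by
    have hT' : (1 : ℝ) ≤ 𝓗.T j := by exact_mod_cast hT
    cases type
    · simp [memTolerance]
    · simp only [memTolerance]; positivity
  have hK0 : 0 < Real.sqrt K := Real.sqrt_pos.2 (by exact_mod_cast hK1)
  rw [div_lt_iff₀ hK0]
  apply lt_of_pow_lt_pow_left₀ 2 (by positivity)
  rw [mul_pow, mul_pow, mul_pow, Real.sq_sqrt (by norm_num), Real.sq_sqrt (Nat.cast_nonneg K)]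
  have : 0 < memTolerance type (𝓗.T j) ^ 2 := by positivity
  nlinarith

theorem exists_retrievalNet {d M : ℕ} {p : ℝ≥0∞} (hp : 1 ≤ p) {𝒳 : Set (TokenSeq d)}
    (h𝒳 : ∀ X ∈ 𝒳, ∀ t, ‖X t‖ ≤ 1) (type : RPEType) (𝓗 : AdaptiveTarget d M p 𝒳)
    (hfin : memoryComplexity type 𝓗 ≠ ∞) (hT : ∀ j, 1 ≤ 𝓗.T j) {H m K : ℕ}
    (hK1 : 1 ≤ K) (hKm : 4 * K ≤ m) (hK : 1568 * (memoryComplexity type 𝓗).toReal < K)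
    (α q : Fin M → Fin (H / 2) → ℝ) (hq : ∀ j i, SummableExponent type (q j i))
    (L : List (ℝ × (Fin (M + 1) × Fin d → ℝ) × ℝ)) (hL : L.length ≤ (M / 2 + 1) * K)
    (z : TokenSeq d → ℤ → EuclideanSpace ℝ (Fin (M + 1) × Fin d))
    (hzdom : ∀ X ∈ 𝒳, ∀ t, z X t ∈ readoutDomain (M + 1) d)
    (hz0 : ∀ X ∈ 𝒳, ∀ t i, z X t (0, i) = X t i)
    (hz : ∀ X ∈ 𝒳, ∀ t j i, z X t (Fin.succ j, i) = ∑' s : ℕ,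
      headKernel type (α j) (q j) (memVal type (𝓗.g j (X t))) s * X (t - s) i)
    {ε : ℝ} (hε : 0 < ε) :
    ∃ F ∈ transformerClass type 𝒳 (M + 1) H m, ∀ X ∈ 𝒳, ∀ t,
      |listNet L (z X t).ofLp - F t X| ≤ M * ε := by
  obtain ⟨R, hR1, hR2, hR3, hR4⟩ := exists_layer_split L hL
  choose G hG1 hG2 using fun j => exists_memNet hp h𝒳 type 𝓗 hfin j (hT j) hK1 hK
  obtain ⟨κ, B, hκ, hprec⟩ := exists_scale_precision type (L.map barronWeight).sum hε
  let N : RetrievalNet type d M (H / 2) H m :=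
    { memNet := G
      readNet := R
      α := α
      p := q
      scale := κ
      shift := B
      -- Even and odd memories use heads of different parity, so that both memories of a layer work
      -- in parallel with `H / 2` heads each.
      head := fun j i => ⟨2 * i + (j : ℕ) % 2, by have := i.2; omega⟩
      summableExponent := hq
      scale_pos := hκ
      four_le := by omega
      length_memNet := fun j => by have := hG1 j; omega
      length_readNet := fun l => by have := hR1 l; omega
      readNet_early := hR3
      head_inj := fun j i j' i' h => by
        simp only [Fin.mk.injEq] at h
        exact ⟨by omega, Fin.ext (by omega)⟩ }
  let μ : Fin M → Token d → ℝ := fun j x => memVal type (𝓗.g j x)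
  have htok : ∀ X ∈ 𝒳, ∀ t, X t ∈ tokenSet 𝒳 := fun X hX t => ⟨X, hX, t, rfl⟩
  have hret : ∀ X ∈ 𝒳, ∀ t, N.retrievedTuple μ X t = (z X t).ofLp := by
    intro X hX t
    ext ⟨j, i⟩
    refine Fin.cases ?_ (fun j => ?_) j
    · exact (hz0 X hX t i).symm
    · exact (hz X hX t j i).symm
  have hz1 : ∀ X ∈ 𝒳, ∀ t i, |z X t i| ≤ 1 := fun X hX t i =>
    abs_apply_le_of_mem_readoutDomain (hzdom X hX t) i
  have hnet : ∀ X ∈ 𝒳, ∀ t l, |listNet (R l) (z X t).ofLp| ≤ (L.map barronWeight).sum :=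
    fun X hX t l => (abs_listNet_le _ (hz1 X hX t)).trans (sum_barronWeight_le_of_sublist (hR2 l))
  have hvalid : ∀ X ∈ 𝒳, N.Valid μ X := by
    intro X hX
    refine ⟨⟨1, fun t i => (abs_apply_le_norm _ i).trans (h𝒳 X hX t)⟩, fun j => ?_, fun j i => ?_,
      fun l => ?_, fun j t => (hG2 j _ (htok X hX t)).1,
      fun h j t => (hG2 j _ (htok X hX t)).2 h, fun h l t => ?_⟩
    · refine ⟨memVal type (𝓗.T j), fun t => ?_⟩
      rw [abs_of_nonneg (memVal_nonneg _ _)]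
      exact memVal_mono type (𝓗.one_le_g j _ (htok X hX t)) (𝓗.g_le j _ (htok X hX t))
    · exact ⟨1, fun t => by
        have := hz1 X hX t (j.succ, i)
        rw [hz X hX t j i] at this
        exact this⟩
    · refine ⟨κ * ε + (κ * (L.map barronWeight).sum + |B|), fun t => ?_⟩
      rw [hret X hX t]
      have h1 := (hprec _ (hnet X hX t l)).1
      have h2 : |κ * listNet (R l) (z X t).ofLp + B| ≤ κ * (L.map barronWeight).sum + |B| := by
        refine (abs_add_le _ _).trans (add_le_add ?_ le_rfl)
        rw [abs_mul, abs_of_pos hκ]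
        exact mul_le_mul_of_nonneg_left (hnet X hX t l) hκ.le
      have h3 := abs_add_le (precision type (κ * listNet (R l) (z X t).ofLp + B) -
        (κ * listNet (R l) (z X t).ofLp + B)) (κ * listNet (R l) (z X t).ofLp + B)
      rw [sub_add_cancel] at h3
      exact h3.trans (add_le_add h1 h2)
    · rw [hret X hX t]
      exact (hprec _ (hnet X hX t l)).2 h
  refine ⟨N.transformer.output type, ⟨_, M, N.transformer, rfl,
    RetrievalNet.wellDefined hvalid, rfl⟩, fun X hX t => ?_⟩
  rw [(hvalid X hX).output_eq, hret X hX t, ← hR4, Finset.sum_range_succ]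
  have e : (∑ l ∈ Finset.range M, listNet (R l) (z X t).ofLp) + listNet (R M) (z X t).ofLp -
      (listNet (R M) (z X t).ofLp + ∑ l ∈ Finset.range M,
        (precision type (κ * listNet (R l) (z X t).ofLp + B) - B) / κ) =
      ∑ l ∈ Finset.range M, (listNet (R l) (z X t).ofLp -
        (precision type (κ * listNet (R l) (z X t).ofLp + B) - B) / κ) := by
    rw [Finset.sum_sub_distrib]
    ring
  change |_ - (listNet (R M) _ + ∑ l ∈ Finset.range M,
    (precision type (κ * listNet (R l) _ + B) - B) / κ)| ≤ _
  rw [e]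
  refine (Finset.abs_sum_le_sum_abs _ _).trans ?_
  calc _ ≤ ∑ _l ∈ Finset.range M, ε := by
        refine Finset.sum_le_sum fun l _ => ?_
        have h1 := (hprec _ (hnet X hX t l)).1
        set y := listNet (R l) (z X t).ofLp
        have e2 : y - (precision type (κ * y + B) - B) / κ =
            -((precision type (κ * y + B) - (κ * y + B)) / κ) := by
          field_simp
          ring
        rw [e2, abs_neg, abs_div, abs_of_pos hκ, div_le_iff₀ hκ, mul_comm ε]
        exact h1
    _ = M * ε := by simp

/-- The factor `√(M + 2)` from the radius of the augmented domain is absorbed by the `M / 2 + 1`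
layers that share the readout neurons. -/
theorem sampling_error_le {M m K : ℕ} (hKm : m ≤ 8 * K) (hK1 : 1 ≤ K) (hm : 1 ≤ m) {V : ℝ}
    (hV : 0 ≤ V) :
    7 * Real.sqrt (((M + 1 : ℕ) : ℝ) + 1) * V / Real.sqrt ((M / 2 + 1) * K : ℕ) ≤
      40 * (V / Real.sqrt m) := by
  have hm0 : 0 < Real.sqrt m := Real.sqrt_pos.2 (by exact_mod_cast hm)
  have hK0 : 0 < Real.sqrt ((M / 2 + 1) * K : ℕ) :=
    Real.sqrt_pos.2 (by exact_mod_cast Nat.mul_pos (Nat.succ_pos _) hK1)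
  have key : 7 * Real.sqrt (((M + 1 : ℕ) : ℝ) + 1) * Real.sqrt m ≤
      40 * Real.sqrt ((M / 2 + 1) * K : ℕ) := by
    apply le_of_sq_le_sq _ (by positivity)
    rw [mul_pow, mul_pow, mul_pow, Real.sq_sqrt (by positivity), Real.sq_sqrt (Nat.cast_nonneg _),
      Real.sq_sqrt (Nat.cast_nonneg _)]
    have h1 : (M + 2) * m ≤ 32 * ((M / 2 + 1) * K) := by
      calc (M + 2) * m ≤ (4 * (M / 2 + 1)) * (8 * K) := Nat.mul_le_mul (by omega) hKm
        _ = _ := by ring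
    have h2 : ((M : ℝ) + 2) * m ≤ 32 * (((M / 2 + 1) * K : ℕ) : ℝ) := by exact_mod_cast h1
    push_cast at h2 ⊢
    nlinarith
  rw [← mul_div_assoc, div_le_div_iff₀ hK0 hm0]
  calc _ = 7 * Real.sqrt (((M + 1 : ℕ) : ℝ) + 1) * Real.sqrt m * V := by ring
    _ ≤ 40 * Real.sqrt ((M / 2 + 1) * K : ℕ) * V := mul_le_mul_of_nonneg_right key hV
    _ = _ := by ring

end

/-! ### The approximation theorem -/

theorem mainTheorem7 :
    ∃ (C₁ C₂ : ℝ) (k₁ k₂ : ℕ) (C : ℕ → ℝ), 0 < C₁ ∧ 0 < C₂ ∧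
      ∀ (type : RPEType) (d M : ℕ) (p : ℝ≥0∞) (_hp : 1 ≤ p) (𝒳 : Set (TokenSeq d))
        (_h𝒳 : ∀ X ∈ 𝒳, ∀ t, ‖X t‖ ≤ 1) (𝓗 : AdaptiveTarget d M p 𝒳)
        (n H m : ℕ) (_hn : 1 ≤ n) (_hH : 1 ≤ H) (_hm : 1 ≤ m)
        (_hfin : memoryComplexity type 𝓗 ≠ ∞)
        (_hwidth : C₁ * (memoryComplexity type 𝓗).toReal *
            (1 + Real.log (1 + (memoryComplexity type 𝓗).toReal)) ^ k₁ ≤ (m : ℝ)),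
        ∃ F ∈ transformerClass type 𝒳 (M + 1) H m,
          seqNorm 𝒳 (fun t X => 𝓗.map t X - F t X) ≤
            ENNReal.ofReal
              (C₂ * (1 + Real.log m) ^ k₂ *
                  ((barronNorm p (readoutDomain (M + 1) d) 𝓗.f).toReal / Real.sqrt m) +
                lipNorm (readoutDomain (M + 1) d) 𝓗.f *
                  (C n / (H : ℝ) ^ n * memoryLength type n 𝓗.T)) := by
  obtain ⟨C, hC⟩ := exists_headKernel
  -- With `K = m / 4 ≥ m / 8`, the first constant exceeds the required `8 * 1568`. The second is 40
  -- for sampling plus 1 for rounding.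
  refine ⟨20000, 41, 0, 0, fun n => |C n|, by norm_num, by norm_num, ?_⟩
  intro type d M p hp 𝒳 h𝒳 𝓗 n H m hn hH hm hfin hwidth
  simp only [pow_zero, mul_one] at hwidth ⊢
  set U := readoutDomain (M + 1) d with hU
  set V := (barronNorm p U 𝓗.f).toReal with hV
  set A := (memoryComplexity type 𝓗).toReal with hA
  have hV0 : 0 ≤ V := ENNReal.toReal_nonneg
  have hm0 : 0 < Real.sqrt m := Real.sqrt_pos.2 (by exact_mod_cast hm)
  have hH0 : (0 : ℝ) < H := by exact_mod_cast hH
  have hattn : 0 ≤ lipNorm U 𝓗.f * (|C n| / (H : ℝ) ^ n * memoryLength type n 𝓗.T) :=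
    mul_nonneg (NNReal.coe_nonneg _)
      (mul_nonneg (by positivity) (memoryLength_nonneg type n 𝓗.T))
  have htarget : ∀ X ∈ 𝒳, ∀ t,
      concatTokens (Fin.cons (X t) fun i => X (t - (𝓗.g i (X t) : ℤ))) ∈ U := by
    intro X hX t
    refine ⟨_, fun j => ?_, rfl⟩
    refine Fin.cases ?_ (fun j => ?_) j
    · exact h𝒳 X hX t
    · exact h𝒳 X hX _
  have hU1 : ∀ x ∈ U, ∀ i, |x i| ≤ 1 := fun x hx i => abs_apply_le_of_mem_readoutDomain hx i
  -- Here zero is good enough, since the target is bounded by `V`. Otherwise the four-way width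
  -- split is possible, the tolerance `ε` below is positive, and an existing token forces every `T
  -- j` to be at least 1.
  by_cases htriv : m < 4 ∨ V = 0 ∨ 𝒳 = ∅
  · refine ⟨_, zero_mem_transformerClass type 𝒳 M H m, seqNorm_le_ofReal fun X hX t => ?_⟩
    rw [sub_zero]
    refine (abs_le_barronNorm hp 𝓗.f_barron.2 (htarget X hX t) (hU1 _ (htarget X hX t))).trans ?_
    rw [← hV]
    refine le_add_of_le_of_nonneg ?_ hattn
    rcases htriv with h | h | h
    · have h1 : Real.sqrt m ≤ 2 := by
        rw [Real.sqrt_le_left (by norm_num)]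
        have : (m : ℝ) ≤ 4 := by exact_mod_cast h.le
        linarith
      rw [← mul_div_assoc, le_div_iff₀ hm0]
      nlinarith
    · rw [h]; simp
    · simp [h] at hX
  push Not at htriv
  obtain ⟨hm4, hVne, ⟨X₀, hX₀⟩⟩ := htriv
  have hVpos : 0 < V := lt_of_le_of_ne hV0 (Ne.symm hVne)
  have hT : ∀ j, 1 ≤ 𝓗.T j := fun j =>
    (𝓗.one_le_g j (X₀ 0) ⟨X₀, hX₀, 0, rfl⟩).trans (𝓗.g_le j (X₀ 0) ⟨X₀, hX₀, 0, rfl⟩)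
  set K := m / 4 with hK
  have hK1 : 1 ≤ K := by omega
  have hmK : m ≤ 8 * K := by omega
  have hKA : 1568 * A < K := by
    have h1 : (m : ℝ) ≤ 8 * K := by exact_mod_cast hmK
    have h2 : (1 : ℝ) ≤ K := by exact_mod_cast hK1
    have h3 : 0 ≤ A := ENNReal.toReal_nonneg
    rcases h3.eq_or_lt with h | h <;> linarith
  choose α q hq hker using fun j : Fin M =>
    hC type n (H / 2) H (𝓗.T j) hn hH (by omega) (hT j)
  obtain ⟨L, hL, hL'⟩ := exists_listNet_approx hp 𝓗.f_barron.2 (r := (M + 1 : ℕ))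
    (fun x hx => norm_sq_le_of_mem_readoutDomain hx) hU1 (Nat.cast_nonneg _)
    (K := (M / 2 + 1) * K) (Nat.mul_pos (Nat.succ_pos _) hK1)
  have htok : ∀ X ∈ 𝒳, ∀ t, X t ∈ tokenSet 𝒳 := fun X hX t => ⟨X, hX, t, rfl⟩
  have hretr : ∀ (X : TokenSeq d) (t : ℤ) (j : Fin M), ∃ z : Token d, X ∈ 𝒳 →
      (∀ i, z i = ∑' s : ℕ,
        headKernel type (α j) (q j) (memVal type (𝓗.g j (X t))) s * X (t - s) i) ∧ ‖z‖ ≤ 1 ∧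
      ‖z - X (t - (𝓗.g j (X t) : ℤ))‖ ≤
        |C n| / (H : ℝ) ^ n * memScale type (𝓗.T j) ^ (n + 1) := by
    intro X t j
    by_cases hX : X ∈ 𝒳
    · obtain ⟨h1, h2, h3⟩ := hker j (𝓗.g j (X t)) (𝓗.one_le_g j _ (htok X hX t))
        (𝓗.g_le j _ (htok X hX t))
      obtain ⟨z, hz1, hz2, hz3⟩ := retrieved_token X (h𝒳 X hX) t _ h1 h2 (𝓗.g j (X t))
      refine ⟨z, fun _ => ⟨hz1, hz2, (hz3.trans h3).trans ?_⟩⟩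
      have := zero_le_one.trans (memScale_pos type (hT j))
      gcongr
      exact le_abs_self _
    · exact ⟨0, fun h => absurd h hX⟩
  choose z hz using hretr
  -- The `M` rounded shares of the readout then contribute at most `V / √m` together.
  set ε := V / Real.sqrt m / (M + 1) with hε
  have hε0 : 0 < ε := by positivity
  have hzdom : ∀ X ∈ 𝒳, ∀ t, concatTokens (Fin.cons (X t) (z X t)) ∈ U := by
    intro X hX t
    refine ⟨_, fun j => ?_, rfl⟩
    refine Fin.cases ?_ (fun j => ?_) j
    · exact h𝒳 X hX t
    · exact (hz X t j hX).2.1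
  obtain ⟨F, hF, hFe⟩ := exists_retrievalNet hp h𝒳 type 𝓗 (m := m) hfin hT hK1 (by omega) hKA α q hq L hL
    (fun X t => concatTokens (Fin.cons (X t) (z X t))) hzdom (fun X _ t i => rfl)
    (fun X hX t j i => (hz X t j hX).1 i) hε0
  refine ⟨F, hF, seqNorm_le_ofReal fun X hX t => ?_⟩
  set x := concatTokens (Fin.cons (X t) fun i => X (t - (𝓗.g i (X t) : ℤ))) with hx
  set y := concatTokens (Fin.cons (X t) (z X t)) with hy
  have hdist : ‖x - y‖ ≤ |C n| / (H : ℝ) ^ n * memoryLength type n 𝓗.T := by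
    rw [memoryLength_eq, ← Real.sqrt_sq (norm_nonneg (x - y)),
      ← Real.sqrt_sq (by positivity : 0 ≤ |C n| / (H : ℝ) ^ n), ← Real.sqrt_mul (sq_nonneg _)]
    apply Real.sqrt_le_sqrt
    rw [hx, hy, norm_concatTokens_sub_sq, Fin.sum_univ_succ, Finset.mul_sum]
    simp only [Fin.cons_zero, Fin.cons_succ, sub_self, norm_zero, ne_eq, OfNat.ofNat_ne_zero,
      not_false_eq_true, zero_pow, zero_add]
    refine Finset.sum_le_sum fun j _ => ?_
    rw [← mul_pow, norm_sub_rev]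
    exact pow_le_pow_left₀ (norm_nonneg _) (hz X t j hX).2.2 2
  have e1 := abs_sub_le_lipNorm_mul 𝓗.f_lip (htarget X hX t) (hzdom X hX t)
  have e2 := (hL' y (hzdom X hX t)).trans (sampling_error_le hmK hK1 hm hV0)
  have e3 := hFe X hX t
  have e4 : M * ε ≤ V / Real.sqrt m := by
    have hM : (0 : ℝ) < M + 1 := by positivity
    rw [hε, mul_div_assoc', div_le_iff₀ hM]
    have : 0 ≤ V / Real.sqrt m := by positivity
    nlinarith
  have e5 : lipNorm U 𝓗.f * ‖x - y‖ ≤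
      lipNorm U 𝓗.f * (|C n| / (H : ℝ) ^ n * memoryLength type n 𝓗.T) :=
    mul_le_mul_of_nonneg_left hdist (NNReal.coe_nonneg _)
  calc |𝓗.map t X - F t X| = |𝓗.f x - F t X| := rfl
    _ ≤ |𝓗.f x - 𝓗.f y| + (|𝓗.f y - listNet L y.ofLp| + |listNet L y.ofLp - F t X|) :=
      (abs_sub_le _ (𝓗.f y) _).trans (add_le_add le_rfl (abs_sub_le _ _ _))
    _ ≤ _ := by linarith
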